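/- A pruned tree on $\mathbb{N}$ is a nonempty set $T$ of finite sequences of natural numbers that is closed under initial segments and such that every $s\in T$ has a proper extension in $T$. Let $\mathcal{T}$ be the space of all pruned trees on $\mathbb{N}$, as a subspace of $2^{(\mathbb{N}^{<\mathbb{N}})}$. The path space $[T]=\{x\in\mathbb{N}^{\mathbb{N}} : x\upharpoonright n\in T \text{ for all } n\}$ carries the ultrametric $d(x,y)=2^{-n}$ for $x\ne y$, where $n$ is least with $x(n)\neq y(n)$. For $S,T\in\mathcal{T}$ write $S\cong_u T$ if there is a bijection $[S]\to[T]$ that is uniformly continuous together with its inverse. Let $\mathrm{GI}$ be the isomorphism relation on the space of (undirected, loopless) graphs with vertex set $\mathbb{N}$, viewed as a subspace of $2^{\mathbb{N}\times\mathbb{N}}$. Then $\mathrm{GI}$ is Borel reducible to $\cong_u$: there is a Borel map $f$ from graphs on $\mathbb{N}$ to $\mathcal{T}$ such that for all graphs $G,H$ on $\mathbb{N}$, $G\cong H$ if and only if $f(G)\cong_u f(H)$. Moreover, $\cong_u$, as a subset of $\mathcal{T}\times\mathcal{T}$, is complete analytic, that is, it is analytic and every analytic subset of a zero-dimensional Polish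 space is its preimage under a continuous map; and it is not Borel. -/

import Mathlib

namespace UniformHomeo

/-- A pruned tree on `ℕ`: a nonempty set of finite sequences of natural numbers that is closed
under initial segments and in which every element has a proper extension. -/
def IsPrunedTree (T : Set (List ℕ)) : Prop :=
  T.Nonempty ∧ (∀ s t : List ℕ, s <+: t → t ∈ T → s ∈ T) ∧
    ∀ s ∈ T, ∃ t ∈ T, s <+: t ∧ s ≠ t

/-- The space of pruned trees, given by characteristic functions. As a subtype of
`List ℕ → Bool` it carries the subspace topology of the product topology (`Bool` discrete) and
the corresponding Borel structure. -/
abbrev PrunedTree : Type :=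
  {χ : List ℕ → Bool // IsPrunedTree {s | χ s = true}}

/-- The path space `[T]` of a pruned tree: the infinite sequences all of whose finite initial
segments `(x 0, …, x (n - 1))` belong to `T`. -/
def PathSpace (T : PrunedTree) : Type :=
  {x : ℕ → ℕ // ∀ n : ℕ, T.1 ((List.range n).map x) = true}

/-- The standard ultrametric on `[T]`: `d(x, y) = 2⁻ⁿ` for `x ≠ y`, where `n` is least such that
`x n ≠ y n`. -/
noncomputable instance (T : PrunedTree) : MetricSpace (PathSpace T) :=
  MetricSpace.induced Subtype.val Subtype.val_injective PiNat.metricSpaceNatNat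

/-- The relation of uniform homeomorphism of path spaces, on pruned trees: there is a bijection
`[S] → [T]` that is uniformly continuous in both directions. -/
def CongU (S T : PrunedTree) : Prop :=
  Nonempty (PathSpace S ≃ᵤ PathSpace T)

/-- The space of (undirected, loopless) graphs with vertex set `ℕ`, given by adjacency functions,
with the topology and the Borel structure inherited from `ℕ × ℕ → Bool`. -/
abbrev GraphOnNat : Type :=
  {A : ℕ × ℕ → Bool // (∀ i j : ℕ, A (i, j) = A (j, i)) ∧ ∀ i : ℕ, A (i, i) = false}

/-- The graph with a given adjacency function. -/
def GraphOnNat.toSimpleGraph (G : GraphOnNat) : SimpleGraph ℕ where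
  Adj i j := G.1 (i, j) = true
  symm := ⟨fun i j h => by rw [← G.2.1 i j]; exact h⟩
  loopless := ⟨fun i h => by simp [G.2.2 i] at h⟩

/-- The isomorphism relation on graphs with vertex set `ℕ`. -/
def GI (G H : GraphOnNat) : Prop :=
  Nonempty (GraphOnNat.toSimpleGraph G ≃g GraphOnNat.toSimpleGraph H)

/-- `E` is Borel reducible to `F`. -/
def BorelReducible {X Y : Type*} [MeasurableSpace X] [MeasurableSpace Y]
    (E : X → X → Prop) (F : Y → Y → Prop) : Prop :=
  ∃ f : X → Y, Measurable f ∧ ∀ x x' : X, E x x' ↔ F (f x) (f x')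

/-- A subset `A` of a Polish space is complete analytic if it is analytic and every analytic
subset of a zero-dimensional Polish space is the preimage of `A` under a continuous map. -/
def IsCompleteAnalytic {X : Type*} [TopologicalSpace X] (A : Set X) : Prop :=
  MeasureTheory.AnalyticSet A ∧
    ∀ (Y : Type) [TopologicalSpace Y] [PolishSpace Y],
      TopologicalSpace.IsTopologicalBasis {U : Set Y | IsClopen U} →
        ∀ B : Set Y, MeasureTheory.AnalyticSet B →
          ∃ f : Y → X, Continuous f ∧ f ⁻¹' A = B

end UniformHomeo

/-! Both reductions send their data to the tree of a `Machine`. A path may wait at a machine state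
`s`, move to a child of `s`, or leave for one of two gadgets, `gad 0` and `gad (M.label s)`. The
paths that remain in `gad l` form a Cantor set, each point of which is a limit of points of
Cantor-Bendixson rank `l` and of no points of rank `l + 1`; so `l` is a topological invariant of
these points, their type. Labels are positive and strictly increase along children. Hence a path
that waits at `s` forever is a limit of points of type `0` and of type `M.label s`, and any other
type accumulating there is larger. A path that moves on infinitely often is a limit of no nonzero
type. So a mere homeomorphism recovers the labels, and once labels determine levels it induces a
bisimulation of the machines (`exists_bisimulation`). Conversely, a bisimulation that matches
children by permutations translates paths letter by letter, which is a uniform homeomorphism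
(`congU_of_bisimulation`).

For a graph, the states are the tuples of vertices, labelled by their atomic types, and a
bisimulation is a back-and-forth system; this reduces `GI`.

For completeness, an analytic set is described by trees `T` depending continuously on the parameter,
membership meaning that `T` has a branch. Compare the Kleene-Brouwer descending sequences in `T`
with those in `T` extended by an infinite descending sequence above it. If `T` has no branch, only
the first order is well-founded, and a bisimulation would detect this. If `T` has a branch, both
orders are ill-founded with the same accessible part, and this suffices for a bisimulation
(`congU_iff_hasBranch`).

The relation is analytic because uniform homeomorphisms are coded by monotone maps between the
trees, under Borel conditions. It is not Borel because a diagonal analytic set with non-analytic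
complement reduces to it. -/

namespace UniformHomeo

open Set Filter Topology

/-! ### Topology and uniformity of path spaces through initial segments -/

section PathSpaces

variable {S T : PrunedTree}

lemma PathSpace.dist_le_pow_iff (x y : PathSpace T) (n : ℕ) :
    dist x y ≤ (1 / 2 : ℝ) ^ n ↔ ∀ i < n, x.1 i = y.1 i := by
  let _ := @PiNat.dist (fun _ => ℕ)
  have h : dist x y = PiNat.dist.dist x.1 y.1 := rfl
  rw [h, ← PiNat.mem_cylinder_iff_dist_le, PiNat.mem_cylinder_iff]

lemma PathSpace.eventually_nhds_iff {x : PathSpace T} {P : PathSpace T → Prop} :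
    (∀ᶠ y in 𝓝 x, P y) ↔ ∃ N, ∀ y : PathSpace T, (∀ i < N, y.1 i = x.1 i) → P y := by
  have hb := Metric.nhds_basis_closedBall_pow (x := x) (r := (1 / 2 : ℝ)) (by norm_num)
    (by norm_num)
  rw [hb.eventually_iff]
  simp only [true_and, Metric.mem_closedBall, PathSpace.dist_le_pow_iff]

lemma PathSpace.mem_closure_iff {x : PathSpace T} {s : Set (PathSpace T)} :
    x ∈ closure s ↔ ∀ N, ∃ y ∈ s, ∀ i < N, y.1 i = x.1 i := by
  rw [mem_closure_iff_frequently, Filter.Frequently, PathSpace.eventually_nhds_iff]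
  push Not
  exact forall_congr' fun N => exists_congr fun y => and_comm

lemma PathSpace.uniformContinuous_iff {f : PathSpace S → PathSpace T} :
    UniformContinuous f ↔ ∀ n, ∃ m, ∀ x y : PathSpace S, (∀ i < m, x.1 i = y.1 i) →
      ∀ i < n, (f x).1 i = (f y).1 i := by
  have hS := Metric.uniformity_basis_dist_le_pow (α := PathSpace S) (r := (1 / 2 : ℝ))
    (by norm_num) (by norm_num)
  have hT := Metric.uniformity_basis_dist_le_pow (α := PathSpace T) (r := (1 / 2 : ℝ))
    (by norm_num) (by norm_num)
  rw [hS.uniformContinuous_iff hT]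
  simp only [true_and, forall_true_left, mem_ofPred_eq, PathSpace.dist_le_pow_iff]

end PathSpaces

/-- A countably branching automaton whose states carry a positive label and a level. -/
structure Machine (σ : Type) where
  label : σ → ℕ
  level : σ → ℕ
  child : σ → ℕ → Option σ
  root : σ
  label_pos : ∀ s, 0 < label s
  level_root : level root = 0
  label_lt : ∀ s a t, child s a = some t → label s < label t
  level_child : ∀ s a t, child s a = some t → level t = level s + 1

/-- The states of the tree generated by a machine with state space `σ`. -/
inductive Node (σ : Type) : Type
  | dead : Node σ
  | scat : ℕ → Node σ
  | gad : ℕ → Node σ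
  | main : σ → Node σ

/-! ### Trees of machines and the runs of their paths -/

namespace Machine

open Node

variable {σ : Type} (M : Machine σ)

/-- The transition function of the tree generated by a machine. -/
def step : Node σ → ℕ → Node σ
  | dead, _ => dead
  | scat k, 0 => scat k
  | scat (k + 1), 1 => scat k
  | scat _, _ => dead
  | gad l, 0 => gad l
  | gad l, 1 => scat l
  | gad l, 2 => gad l
  | gad _, _ => dead
  | main s, 0 => main s
  | main s, 1 => gad (M.label s)
  | main _, 2 => gad 0
  | main s, a + 3 => (M.child s a).elim dead main

/-- The state reached along a finite word. -/
def runList (w : List ℕ) : Node σ := w.foldl M.step (main M.root)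

/-- Whether a state is not the dead one. -/
def _root_.UniformHomeo.Node.alive : Node σ → Bool
  | dead => false
  | _ => true

lemma alive_iff {p : Node σ} : p.alive = true ↔ p ≠ dead := by
  cases p <;> simp [Node.alive]

@[simp] lemma step_dead (a : ℕ) : M.step dead a = dead := rfl

@[simp] lemma step_zero (p : Node σ) : M.step p 0 = p := by
  rcases p with _ | (_ | _) | _ | _ <;> rfl

lemma foldl_dead (w : List ℕ) : w.foldl M.step dead = dead := by
  induction w with
  | nil => rfl
  | cons a w ih => simpa using ih

lemma isPrunedTree : IsPrunedTree {w | (M.runList w).alive = true} := by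
  refine ⟨⟨[], rfl⟩, ?_, ?_⟩
  · rintro s _ ⟨u, rfl⟩ h
    simp only [mem_ofPred_eq, alive_iff, runList, List.foldl_append] at h ⊢
    intro h'
    rw [h', foldl_dead] at h
    exact h rfl
  · intro s hs
    refine ⟨s ++ [0], ?_, ⟨[0], rfl⟩, by simp⟩
    simpa [runList] using hs

/-- The pruned tree of all words along which a machine survives. -/
def tree : PrunedTree := ⟨fun w => (M.runList w).alive, M.isPrunedTree⟩

/-- The state reached after reading the first `n` letters of a sequence. -/
def run (x : ℕ → ℕ) : ℕ → Node σ
  | 0 => main M.root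
  | n + 1 => M.step (run x n) (x n)

@[simp] lemma run_zero (x : ℕ → ℕ) : M.run x 0 = main M.root := rfl

lemma run_succ (x : ℕ → ℕ) (n : ℕ) : M.run x (n + 1) = M.step (M.run x n) (x n) := rfl

lemma runList_map_range (x : ℕ → ℕ) (n : ℕ) : M.runList ((List.range n).map x) = M.run x n := by
  induction n with
  | zero => rfl
  | succ n ih =>
    rw [List.range_succ, List.map_append, runList, List.foldl_append, ← runList, ih]
    rfl

lemma tree_iff (x : ℕ → ℕ) :
    (∀ n, M.tree.1 ((List.range n).map x) = true) ↔ ∀ n, M.run x n ≠ dead := by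
  simp only [tree, runList_map_range, alive_iff]

/-- The path space of the tree generated by a machine. -/
abbrev Paths : Type := PathSpace M.tree

variable {M}

lemma run_ne_dead (x : M.Paths) (n : ℕ) : M.run x.1 n ≠ dead := (M.tree_iff x.1).1 x.2 n

lemma run_congr {x y : ℕ → ℕ} {N : ℕ} (h : ∀ i < N, y i = x i) {n : ℕ} (hn : n ≤ N) :
    M.run y n = M.run x n := by
  induction n with
  | zero => rfl
  | succ n ih => rw [run_succ, run_succ, ih (by omega), h n (by omega)]

/-- Follow a path up to `N`, then read `w`, then stay put. -/
lemma exists_path (x : M.Paths) (N : ℕ) (w : List ℕ) (hq : w.foldl M.step (M.run x.1 N) ≠ dead) :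
    ∃ z : M.Paths, (∀ i < N, z.1 i = x.1 i) ∧ (∀ i, z.1 (N + i) = w.getD i 0) ∧
      ∀ m, N + w.length ≤ m → M.run z.1 m = w.foldl M.step (M.run x.1 N) := by
  let z : ℕ → ℕ := fun i => if i < N then x.1 i else w.getD (i - N) 0
  have h1 : ∀ i < N, z i = x.1 i := fun i hi => by simp [z, hi]
  have h2 : ∀ i, z (N + i) = w.getD i 0 := fun i => by simp [z]
  have h3 : ∀ j, j ≤ w.length → M.run z (N + j) = (w.take j).foldl M.step (M.run x.1 N) := by
    intro j
    induction j with
    | zero => intro _; simpa using run_congr h1 le_rfl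
    | succ j ih =>
      intro hj
      rw [← Nat.add_assoc, run_succ, ih (by omega), h2, List.getD_eq_getElem _ _ hj,
        ← List.take_append_getElem hj, List.foldl_append]
      rfl
  have h4 : ∀ j, M.run z (N + w.length + j) = w.foldl M.step (M.run x.1 N) := by
    intro j
    induction j with
    | zero => simpa using h3 _ le_rfl
    | succ j ih =>
      rw [← Nat.add_assoc, run_succ, ih, Nat.add_assoc, h2]
      simp
  have hdead : ∀ n m, n ≤ m → M.run z n = dead → M.run z m = dead := by
    intro n m hnm hn
    induction m, hnm using Nat.le_induction with
    | base => exact hn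
    | succ m _ ih => rw [run_succ, ih]; rfl
  refine ⟨⟨z, (M.tree_iff z).2 fun n hn => hq ?_⟩, h1, h2, fun m hm => ?_⟩
  · rw [← h4 n]
    exact hdead n _ (by omega) hn
  · obtain ⟨j, rfl⟩ := Nat.exists_eq_add_of_le hm
    exact h4 j

/-- The immediate successor states. -/
lemma step_scat {k a : ℕ} {p : Node σ} (h : M.step (scat k) a = p) (hp : p ≠ dead) :
    (a = 0 ∧ p = scat k) ∨ (∃ j, a = 1 ∧ k = j + 1 ∧ p = scat j) := by
  subst h
  rcases k with _ | k <;> rcases a with _ | _ | a <;> simp_all [step]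

lemma step_gad {l a : ℕ} {p : Node σ} (h : M.step (gad l) a = p) (hp : p ≠ dead) :
    p = gad l ∨ p = scat l := by
  subst h
  rcases a with _ | _ | _ | a <;> simp_all [step]

lemma step_main {s : σ} {a : ℕ} {p : Node σ} (h : M.step (main s) a = p) (hp : p ≠ dead) :
    p = main s ∨ p = gad (M.label s) ∨ p = gad 0 ∨
      ∃ b t, a = b + 3 ∧ M.child s b = some t ∧ p = main t := by
  subst h
  rcases a with _ | _ | _ | a
  · simp
  · simp [step]
  · simp [step]
  · rcases hc : M.child s a with _ | t <;> simp_all [step]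

lemma run_scat_of_le {x : M.Paths} {n m k : ℕ} (h : M.run x.1 n = scat k) (hnm : n ≤ m) :
    ∃ j ≤ k, M.run x.1 m = scat j := by
  induction m, hnm using Nat.le_induction with
  | base => exact ⟨k, le_rfl, h⟩
  | succ m _ ih =>
    obtain ⟨j, hj, hm⟩ := ih
    have hs := M.run_succ x.1 m
    rw [hm] at hs
    rcases step_scat hs.symm (run_ne_dead x _) with ⟨-, h⟩ | ⟨i, -, rfl, h⟩
    · exact ⟨j, hj, h⟩
    · exact ⟨i, by omega, h⟩

lemma run_gad_of_le {x : M.Paths} {n m l : ℕ} (h : M.run x.1 n = gad l) (hnm : n ≤ m) :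
    M.run x.1 m = gad l ∨ ∃ j ≤ l, M.run x.1 m = scat j := by
  induction m, hnm using Nat.le_induction with
  | base => exact .inl h
  | succ m _ ih =>
    rcases ih with hm | ⟨j, hj, hm⟩
    · have hs := M.run_succ x.1 m
      rw [hm] at hs
      rcases step_gad hs.symm (run_ne_dead x _) with h | h
      · exact .inl h
      · exact .inr ⟨l, le_rfl, h⟩
    · obtain ⟨i, hi, h'⟩ := run_scat_of_le hm (Nat.le_succ m)
      exact .inr ⟨i, hi.trans hj, h'⟩

/-- The possible later states of a path that passes through a main state. -/
lemma run_main_of_le {x : M.Paths} {n m : ℕ} {s : σ} (h : M.run x.1 n = main s) (hnm : n ≤ m) :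
    (∃ k, M.run x.1 m = scat k) ∨ (∃ l, (l = 0 ∨ M.label s ≤ l) ∧ M.run x.1 m = gad l) ∨
      ∃ t, M.run x.1 m = main t ∧ (t = s ∨ M.label s < M.label t ∧
        ((∃ b, M.child s b = some t) ∨ M.level s + 2 ≤ M.level t)) := by
  induction m, hnm using Nat.le_induction with
  | base => exact .inr (.inr ⟨s, h, .inl rfl⟩)
  | succ m _ ih =>
    have hs := M.run_succ x.1 m
    rcases ih with ⟨k, hm⟩ | ⟨l, hl, hm⟩ | ⟨t, hm, ht⟩
    · obtain ⟨j, -, h⟩ := run_scat_of_le hm (Nat.le_succ m)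
      exact .inl ⟨j, h⟩
    · rcases run_gad_of_le hm (Nat.le_succ m) with h | ⟨j, -, h⟩
      · exact .inr (.inl ⟨l, hl, h⟩)
      · exact .inl ⟨j, h⟩
    · rw [hm] at hs
      have hle : M.label s ≤ M.label t := by
        rcases ht with rfl | ht
        · exact le_rfl
        · exact ht.1.le
      rcases step_main hs.symm (run_ne_dead x _) with h | h | h | ⟨b, u, -, hc, h⟩
      · exact .inr (.inr ⟨t, h, ht⟩)
      · exact .inr (.inl ⟨_, .inr hle, h⟩)
      · exact .inr (.inl ⟨_, .inl rfl, h⟩)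
      · refine .inr (.inr ⟨u, h, .inr ⟨hle.trans_lt (M.label_lt _ _ _ hc), ?_⟩⟩)
        have hu := M.level_child _ _ _ hc
        rcases ht with rfl | ⟨-, ⟨b', hb'⟩ | ht⟩
        · exact .inl ⟨b, hc⟩
        · have := M.level_child _ _ _ hb'
          exact .inr (by omega)
        · exact .inr (by omega)

end Machine

end UniformHomeo

namespace UniformHomeo

open Set Filter Topology

/-! ### Topological invariants from Cantor-Bendixson ranks -/

section Invariants

variable (X : Type*) [TopologicalSpace X]

/-- The points of Cantor-Bendixson rank less than `k`. -/
def rankLT : ℕ → Set X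
  | 0 => ∅
  | k + 1 => {x | ∀ᶠ y in 𝓝[≠] x, y ∈ rankLT k}

/-- The points of Cantor-Bendixson rank `k`. -/
def rankEq (k : ℕ) : Set X := rankLT X (k + 1) \ rankLT X k

/-- The points without finite Cantor-Bendixson rank. -/
def unranked : Set X := {x | ∀ k, x ∉ rankLT X k}

/-- The unranked points near which all unranked points are limits of points of rank `l`, but not of
points of rank `l + 1`. -/
def uniformType (l : ℕ) : Set X :=
  {x | x ∈ unranked X ∧ ∀ᶠ y in 𝓝 x, y ∈ unranked X →
    y ∈ closure (rankEq X l) ∧ y ∉ closure (rankEq X (l + 1))}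

variable {X}

/-- The types that accumulate at `x` are `0` and others, the least of which is `l`. -/
def HasLabel (x : X) (l : ℕ) : Prop :=
  l ≠ 0 ∧ x ∈ closure (uniformType X 0) ∧ x ∈ closure (uniformType X l) ∧
    ∀ m, m ≠ 0 → x ∈ closure (uniformType X m) → l ≤ m

variable {Y : Type*} [TopologicalSpace Y] (F : X ≃ₜ Y)

lemma preimage_rankLT (k : ℕ) : F ⁻¹' rankLT Y k = rankLT X k := by
  induction k with
  | zero => rfl
  | succ k ih =>
    ext x
    simp only [rankLT, mem_preimage, mem_ofPred_eq, ← F.map_punctured_nhds_eq, eventually_map]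
    rw [← ih]
    rfl

lemma preimage_rankEq (k : ℕ) : F ⁻¹' rankEq Y k = rankEq X k := by
  simp [rankEq, preimage_rankLT]

lemma mem_unranked_iff (x : X) : F x ∈ unranked Y ↔ x ∈ unranked X := by
  simp only [unranked, mem_ofPred_eq, ← preimage_rankLT F, mem_preimage]

lemma preimage_uniformType (l : ℕ) : F ⁻¹' uniformType Y l = uniformType X l := by
  ext x
  simp only [uniformType, mem_preimage, mem_ofPred_eq, ← F.map_nhds_eq, eventually_map,
    mem_unranked_iff, ← preimage_rankEq F, ← F.preimage_closure]

lemma hasLabel_iff (x : X) (l : ℕ) : HasLabel (F x) l ↔ HasLabel x l := by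
  simp only [HasLabel, ← preimage_uniformType F, ← F.preimage_closure, mem_preimage]

end Invariants

/-! ### Recovering labels from the topology -/

namespace Machine

open Node

variable {σ : Type} {M : Machine σ}

/-- A path that is eventually in the main state `s`. -/
def StaysAt (x : M.Paths) (s : σ) : Prop := ∃ N, ∀ n, N ≤ n → M.run x.1 n = main s

lemma StaysAt.unique {x : M.Paths} {s t : σ} (hs : StaysAt x s) (ht : StaysAt x t) : s = t := by
  obtain ⟨N, hN⟩ := hs
  obtain ⟨N', hN'⟩ := ht
  have := (hN (max N N') (le_max_left _ _)).symm.trans (hN' _ (le_max_right _ _))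
  simpa using this

/-- In `scat k` only `k` further decrements are possible, so the path that stays there is approached
only by paths settling at lower counters. Gadget and main states always offer a second continuation
that avoids small counters, so they never produce a finite rank. -/
lemma mem_rankLT_iff (k : ℕ) (x : M.Paths) :
    x ∈ rankLT M.Paths k ↔ ∃ n, ∃ j < k, M.run x.1 n = scat j := by
  induction k generalizing x with
  | zero => simp [rankLT]
  | succ k ih =>
    simp only [rankLT, mem_ofPred_eq, eventually_nhdsWithin_iff, PathSpace.eventually_nhds_iff,
      mem_compl_iff, mem_singleton_iff]
    constructor
    · rintro ⟨N, hN⟩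
      by_contra hx
      push Not at hx
      -- Two continuations with different first letters, both avoiding the counters below `k`. At
      -- least one leaves `x`, so it gives a nearby point, other than `x`, outside `rankLT k`.
      obtain ⟨w₁, w₂, h₁, h₂, hw, hi⟩ : ∃ w₁ w₂ : List ℕ,
          (∀ j < k, w₁.foldl M.step (M.run x.1 N) ≠ scat j) ∧
          (∀ j < k, w₂.foldl M.step (M.run x.1 N) ≠ scat j) ∧
          (w₁.foldl M.step (M.run x.1 N) ≠ dead ∧ w₂.foldl M.step (M.run x.1 N) ≠ dead) ∧
          w₁.getD 0 0 ≠ w₂.getD 0 0 := by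
        rcases hp : M.run x.1 N with _ | j | l | s
        · exact absurd hp (run_ne_dead x N)
        · have hj : k < j := by
            by_contra hj
            exact hx N j (by omega) hp
          obtain ⟨j, rfl⟩ := Nat.exists_eq_add_of_lt hj
          refine ⟨[0], [1], ?_, ?_, ⟨by simp, by simp [step]⟩, by simp⟩
          · intro i hi h
            simp at h
            omega
          · intro i hi h
            simp [step] at h
            omega
        · exact ⟨[0], [2], by simp, by simp [step], by simp [step], by simp⟩
        · exact ⟨[0], [1], by simp, by simp [step], by simp [step], by simp⟩
      have key : ∀ w : List ℕ, (∀ j < k, w.foldl M.step (M.run x.1 N) ≠ scat j) →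
          w.foldl M.step (M.run x.1 N) ≠ dead → w.getD 0 0 = x.1 N := by
        intro w hw hd
        obtain ⟨z, hz, hzw, hzr⟩ := exists_path x N w hd
        have hzx : z = x := by
          by_contra hne
          obtain ⟨n, j, hj, hn⟩ := (ih z).1 (hN z hz hne)
          obtain ⟨i, hi, h⟩ := run_scat_of_le hn (le_max_left n (N + w.length))
          rw [hzr _ (le_max_right _ _)] at h
          exact hw i (by omega) h
        rw [← hzx, ← hzw 0, Nat.add_zero]
      exact hi ((key w₁ h₁ hw.1).trans (key w₂ h₂ hw.2).symm)
    · rintro ⟨n, j, hj, hn⟩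
      -- After reaching its least counter value the path reads only zeros, so a different path
      -- agreeing up to `n₀` must decrement further.
      obtain ⟨j₀, n₀, hn₀, hj₀, hmin⟩ : ∃ j₀ n₀, M.run x.1 n₀ = scat j₀ ∧ j₀ ≤ j ∧
          ∀ m i, M.run x.1 m = scat i → j₀ ≤ i := by
        classical
        have hex : ∃ j n, M.run x.1 n = scat j := ⟨j, n, hn⟩
        obtain ⟨n₀, hn₀⟩ := Nat.find_spec hex
        exact ⟨Nat.find hex, n₀, hn₀, Nat.find_min' hex ⟨n, hn⟩,
          fun m i h => Nat.find_min' hex ⟨m, h⟩⟩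
      have hstay : ∀ m, n₀ ≤ m → M.run x.1 m = scat j₀ := by
        intro m hm
        obtain ⟨i, hi, h⟩ := run_scat_of_le hn₀ hm
        rw [h, le_antisymm hi (hmin _ _ h)]
      have hzero : ∀ m, n₀ ≤ m → x.1 m = 0 := by
        intro m hm
        have hs := M.run_succ x.1 m
        rw [hstay m hm, hstay (m + 1) (by omega)] at hs
        rcases step_scat hs.symm (by simp) with ⟨h, -⟩ | ⟨i, -, h, h'⟩
        · exact h
        · simp at h'
          omega
      refine ⟨n₀, fun y hy hne => (ih y).2 ?_⟩
      by_contra hcon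
      push Not at hcon
      have hy₀ : ∀ m, n₀ ≤ m → M.run y.1 m = scat j₀ := by
        intro m hm
        obtain ⟨i, hi, h⟩ := run_scat_of_le (x := y) ((run_congr hy le_rfl).trans hn₀) hm
        have := hcon m i
        rcases hi.lt_or_eq with hlt | rfl
        · exact absurd h (this (by omega))
        · exact h
      apply hne
      apply Subtype.ext
      funext m
      rcases lt_or_ge m n₀ with hm | hm
      · exact hy m hm
      · rw [hzero m hm]
        have hs := M.run_succ y.1 m
        rw [hy₀ m hm, hy₀ (m + 1) (by omega)] at hs
        rcases step_scat hs.symm (by simp) with ⟨h, -⟩ | ⟨i, -, h, h'⟩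
        · exact h
        · simp at h'
          omega

lemma mem_unranked_iff_run (x : M.Paths) : x ∈ unranked M.Paths ↔ ∀ n k, M.run x.1 n ≠ scat k := by
  simp only [unranked, mem_ofPred_eq, mem_rankLT_iff]
  push Not
  exact ⟨fun h n k => h (k + 1) n k (Nat.lt_succ_self k), fun h k n j _ => h n j⟩

lemma mem_rankEq_of_run {x : M.Paths} {N k : ℕ} (h : ∀ n, N ≤ n → M.run x.1 n = scat k) :
    x ∈ rankEq M.Paths k := by
  refine ⟨(mem_rankLT_iff _ _).2 ⟨N, k, Nat.lt_succ_self k, h N le_rfl⟩, fun hx => ?_⟩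
  obtain ⟨n, j, hj, hn⟩ := (mem_rankLT_iff _ _).1 hx
  obtain ⟨i, hi, h'⟩ := run_scat_of_le hn (le_max_left n N)
  rw [h _ (le_max_right _ _)] at h'
  simp at h'
  omega

lemma exists_run_of_mem_rankEq {x : M.Paths} {k : ℕ} (h : x ∈ rankEq M.Paths k) :
    ∃ n, M.run x.1 n = scat k := by
  obtain ⟨n, j, hj, hn⟩ := (mem_rankLT_iff _ _).1 h.1
  rcases (Nat.lt_succ_iff.1 hj).lt_or_eq with hlt | rfl
  · exact absurd ((mem_rankLT_iff _ _).2 ⟨n, j, hlt, hn⟩) h.2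
  · exact ⟨n, hn⟩

lemma foldl_scat (k j : ℕ) : (List.replicate j 1).foldl M.step (scat (k + j)) = scat k := by
  induction j with
  | zero => rfl
  | succ j ih => rw [List.replicate_succ, List.foldl_cons, ← ih, ← Nat.add_assoc]; rfl

lemma run_gad_of_unranked {x : M.Paths} {n m l : ℕ} (hx : x ∈ unranked M.Paths)
    (h : M.run x.1 n = gad l) (hnm : n ≤ m) : M.run x.1 m = gad l := by
  rcases run_gad_of_le h hnm with h | ⟨j, -, h⟩
  · exact h
  · exact absurd h ((mem_unranked_iff_run x).1 hx m j)

/-- A path can leave `gad l` only for `scat l`, whose counter can then be lowered to any `k ≤ l` but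
never raised; and it can leave arbitrarily late. -/
lemma mem_closure_rankEq_iff {x : M.Paths} {N l : ℕ} (hx : x ∈ unranked M.Paths)
    (h : M.run x.1 N = gad l) (k : ℕ) : x ∈ closure (rankEq M.Paths k) ↔ k ≤ l := by
  rw [PathSpace.mem_closure_iff]
  constructor
  · intro hc
    obtain ⟨y, hy, hyx⟩ := hc N
    obtain ⟨n, hn⟩ := exists_run_of_mem_rankEq hy
    have hyN : M.run y.1 N = gad l := (run_congr hyx le_rfl).trans h
    rcases le_total n N with hnN | hnN
    · obtain ⟨j, -, h'⟩ := run_scat_of_le hn hnN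
      rw [hyN] at h'
      simp at h'
    · rcases run_gad_of_le hyN hnN with h' | ⟨j, hj, h'⟩
      · rw [hn] at h'
        simp at h'
      · rw [hn] at h'
        simp at h'
        omega
  · rintro hk N'
    obtain ⟨d, rfl⟩ := Nat.exists_eq_add_of_le hk
    have hr : M.run x.1 (max N N') = gad (k + d) := run_gad_of_unranked hx h (le_max_left _ _)
    have hf : (1 :: List.replicate d 1).foldl M.step (M.run x.1 (max N N')) = scat k := by
      rw [hr, List.foldl_cons, ← foldl_scat (M := M) k d]
      rfl
    obtain ⟨z, hz, -, hzr⟩ := exists_path x (max N N') (1 :: List.replicate d 1) (by simp [hf])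
    exact ⟨z, mem_rankEq_of_run fun n hn => (hzr n hn).trans hf,
      fun i hi => hz i (hi.trans_le (le_max_right _ _))⟩

lemma mem_unranked_of_stays {x : M.Paths} {N : ℕ} {p : Node σ} (h : ∀ n, N ≤ n → M.run x.1 n = p)
    (hp : ∀ k, p ≠ scat k) : x ∈ unranked M.Paths := by
  rw [mem_unranked_iff_run]
  intro n k hn
  obtain ⟨j, -, h'⟩ := run_scat_of_le hn (le_max_left n N)
  rw [h _ (le_max_right _ _)] at h'
  exact hp j h'

/-- Next to a path in a main state there are paths ending in the two gadgets available there. -/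
lemma exists_path_gad (x : M.Paths) {N : ℕ} {s : σ} (h : M.run x.1 N = main s) {l : ℕ}
    (hl : l = 0 ∨ l = M.label s) :
    ∃ y ∈ unranked M.Paths, (∀ i < N, y.1 i = x.1 i) ∧ ∃ n, M.run y.1 n = gad l := by
  obtain ⟨a, ha⟩ : ∃ a, M.step (main s) a = gad l := by
    rcases hl with rfl | rfl
    · exact ⟨2, rfl⟩
    · exact ⟨1, rfl⟩
  have hf : [a].foldl M.step (M.run x.1 N) = gad l := by rw [h]; exact ha
  obtain ⟨z, hz, -, hzr⟩ := exists_path x N [a] (by simp [hf])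
  rw [hf] at hzr
  exact ⟨z, mem_unranked_of_stays hzr (by simp), hz, _, hzr _ le_rfl⟩

lemma mem_uniformType_iff (x : M.Paths) (l : ℕ) :
    x ∈ uniformType M.Paths l ↔ x ∈ unranked M.Paths ∧ ∃ n, M.run x.1 n = gad l := by
  refine and_congr_right fun hx => ?_
  rw [PathSpace.eventually_nhds_iff]
  constructor
  · rintro ⟨N, hN⟩
    rcases hp : M.run x.1 N with _ | k | l' | s
    · exact absurd hp (run_ne_dead x N)
    · exact absurd hp ((mem_unranked_iff_run x).1 hx N k)
    · have h := hN x (fun _ _ => rfl) hx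
      rw [mem_closure_rankEq_iff hx hp, mem_closure_rankEq_iff hx hp] at h
      obtain rfl : l' = l := by omega
      exact ⟨N, hp⟩
    · exfalso
      -- Near a main state both gadgets occur, and their types differ because labels are positive.
      have key : ∀ l', l' = 0 ∨ l' = M.label s → l' = l := by
        intro l' hl'
        obtain ⟨y, hy, hyx, n, hn⟩ := exists_path_gad x hp hl'
        have h := hN y hyx hy
        rw [mem_closure_rankEq_iff hy hn, mem_closure_rankEq_iff hy hn] at h
        omega
      have h₁ := key 0 (.inl rfl)
      have h₂ := key _ (.inr rfl)
      have := M.label_pos s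
      omega
  · rintro ⟨N, hN⟩
    refine ⟨N, fun y hy hyu => ?_⟩
    have h := (run_congr hy le_rfl).trans hN
    rw [mem_closure_rankEq_iff hyu h, mem_closure_rankEq_iff hyu h]
    omega

lemma eq_of_mem_closure_uniformType {x : M.Paths} {N l m : ℕ} (h : M.run x.1 N = gad l)
    (hm : x ∈ closure (uniformType M.Paths m)) : m = l := by
  obtain ⟨y, hy, hyx⟩ := PathSpace.mem_closure_iff.1 hm N
  obtain ⟨hyu, n, hn⟩ := (mem_uniformType_iff _ _).1 hy
  have h₁ := run_gad_of_unranked hyu hn (le_max_left n N)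
  have h₂ := run_gad_of_unranked hyu ((run_congr hyx le_rfl).trans h) (le_max_right n N)
  simpa using h₁.symm.trans h₂

lemma run_ne_scat_of_mem_closure_uniformType {x : M.Paths} {m : ℕ}
    (hm : x ∈ closure (uniformType M.Paths m)) (N k : ℕ) : M.run x.1 N ≠ scat k := by
  intro h
  obtain ⟨y, hy, hyx⟩ := PathSpace.mem_closure_iff.1 hm N
  exact (mem_unranked_iff_run y).1 hy.1 N k ((run_congr hyx le_rfl).trans h)

lemma le_of_mem_closure_uniformType {x : M.Paths} {N m : ℕ} {s : σ} (h : M.run x.1 N = main s)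
    (hm : x ∈ closure (uniformType M.Paths m)) : m = 0 ∨ M.label s ≤ m := by
  obtain ⟨y, hy, hyx⟩ := PathSpace.mem_closure_iff.1 hm N
  obtain ⟨hyu, n, hn⟩ := (mem_uniformType_iff _ _).1 hy
  have h₁ := run_gad_of_unranked hyu hn (le_max_left n N)
  rcases run_main_of_le ((run_congr hyx le_rfl).trans h) (le_max_right n N) with
    ⟨k, h₂⟩ | ⟨l, hl, h₂⟩ | ⟨t, h₂, -⟩
  · simp [h₁] at h₂
  · simp [h₁] at h₂
    exact h₂ ▸ hl
  · simp [h₁] at h₂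

lemma StaysAt.hasLabel {x : M.Paths} {s : σ} (h : StaysAt x s) : HasLabel x (M.label s) := by
  obtain ⟨N, hN⟩ := h
  have key : ∀ l, l = 0 ∨ l = M.label s → x ∈ closure (uniformType M.Paths l) := by
    intro l hl
    rw [PathSpace.mem_closure_iff]
    intro N'
    obtain ⟨y, hy, hyx, hn⟩ := exists_path_gad x (hN _ (le_max_left N N')) hl
    exact ⟨y, (mem_uniformType_iff _ _).2 ⟨hy, hn⟩,
      fun i hi => hyx i (hi.trans_le (le_max_right _ _))⟩
  refine ⟨(M.label_pos s).ne', key 0 (.inl rfl), key _ (.inr rfl), fun m hm hx => ?_⟩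
  exact (le_of_mem_closure_uniformType (hN N le_rfl) hx).resolve_left hm

/-- Two different types accumulate at `x`, so it never enters a gadget, where only one type is seen.
The labels it visits are bounded by `l`, and every move to a child increases the label, so the path
comes to rest. -/
lemma exists_staysAt {x : M.Paths} {l : ℕ} (h : HasLabel x l) : ∃ s, StaysAt x s ∧ M.label s = l := by
  obtain ⟨hl, h0, hxl, hmin⟩ := h
  have hmain : ∀ n, ∃ s, M.run x.1 n = main s := by
    intro n
    rcases hp : M.run x.1 n with _ | k | l' | s
    · exact absurd hp (run_ne_dead x n)
    · exact absurd hp (run_ne_scat_of_mem_closure_uniformType h0 n k)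
    · have h₁ := eq_of_mem_closure_uniformType hp h0
      have h₂ := eq_of_mem_closure_uniformType hp hxl
      omega
    · exact ⟨s, rfl⟩
  choose f hf using hmain
  have hle : ∀ n, M.label (f n) ≤ l := fun n =>
    (le_of_mem_closure_uniformType (hf n) hxl).resolve_left hl
  obtain ⟨N, hN⟩ : ∃ N, ∀ n, M.label (f n) ≤ M.label (f N) := by
    obtain ⟨_, ⟨N, rfl⟩, hN⟩ :=
      WellFounded.has_min (measure fun k => l - k).wf (range fun n => M.label (f n)) ⟨_, 0, rfl⟩
    refine ⟨N, fun n => ?_⟩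
    have h : ¬ (l - M.label (f n) < l - M.label (f N)) := hN _ ⟨n, rfl⟩
    have := hle n
    have := hle N
    omega
  have hs : StaysAt x (f N) := by
    refine ⟨N, fun n hn => ?_⟩
    rcases run_main_of_le (hf N) hn with ⟨k, h₂⟩ | ⟨l, hl, h₂⟩ | ⟨t, h₂, ht⟩
    · simp [hf n] at h₂
    · simp [hf n] at h₂
    · rcases ht with rfl | ⟨ht, -⟩
      · exact h₂
      · have : f n = t := by simpa [hf n] using h₂
        have := hN n
        simp_all
        omega
  refine ⟨f N, hs, le_antisymm (hle N) ?_⟩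
  exact hmin _ (M.label_pos _).ne' hs.hasLabel.2.2.1

/-! ### From homeomorphisms to bisimulations -/

section Bisimulation

variable {τ : Type} {M' : Machine τ}

/-- Wait at `s` for a long time, then move to `s'`. By continuity the image still passes through
`t`, and it must come to rest at a state carrying the label of `s'`. Equal labels force equal
levels, so that state is exactly one level below `t`. -/
lemma exists_child_of_homeomorph (F : M.Paths ≃ₜ M'.Paths)
    (hlev : ∀ s t, M.label s = M'.label t → M.level s = M'.level t) {x : M.Paths} {s s' : σ} {t : τ}
    (hs : StaysAt x s) (ht : StaysAt (F x) t) {a : ℕ} (ha : M.child s a = some s') :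
    ∃ b t', M'.child t b = some t' ∧ ∃ y, StaysAt y s' ∧ StaysAt (F y) t' := by
  obtain ⟨N, hN⟩ := hs
  have hst : M.label s = M'.label t := by
    obtain ⟨t₁, h₁, h₂⟩ := exists_staysAt ((hasLabel_iff F x _).2 (StaysAt.hasLabel ⟨N, hN⟩))
    rw [← h₂, h₁.unique ht]
  obtain ⟨N', hN'⟩ := ht
  have hF : ∀ᶠ y in 𝓝 x, ∀ i < N', (F y).1 i = (F x).1 i :=
    F.continuous.continuousAt.eventually (p := fun z => ∀ i < N', z.1 i = (F x).1 i)
      (PathSpace.eventually_nhds_iff.2 ⟨N', fun _ h => h⟩)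
  obtain ⟨N₁, hN₁⟩ := PathSpace.eventually_nhds_iff.1 hF
  have hf : [a + 3].foldl M.step (M.run x.1 (max N N₁)) = main s' := by
    rw [hN _ (le_max_left _ _)]
    simp [step, ha]
  obtain ⟨y, hy, -, hyr⟩ := exists_path x (max N N₁) [a + 3] (by simp [hf])
  rw [hf] at hyr
  have hys : StaysAt y s' := ⟨_, hyr⟩
  obtain ⟨t', ht', hlab⟩ := exists_staysAt ((hasLabel_iff F y _).2 hys.hasLabel)
  have hFy := hN₁ y fun i hi => hy i (hi.trans_le (le_max_right _ _))
  have hrun : M'.run (F y).1 N' = main t := (run_congr hFy le_rfl).trans (hN' _ le_rfl)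
  obtain ⟨K, hK⟩ := ht'
  have h₁ := hlev _ _ hst
  have h₂ := hlev _ _ hlab.symm
  have h₃ := M.level_child _ _ _ ha
  rcases run_main_of_le hrun (le_max_left N' K) with ⟨k, h⟩ | ⟨l, hl, h⟩ | ⟨u, h, hu⟩
  · simp [hK _ (le_max_right N' K)] at h
  · simp [hK _ (le_max_right N' K)] at h
  · obtain rfl : t' = u := by simpa [hK _ (le_max_right N' K)] using h
    -- The level of `t'` is that of `t` plus one, which rules out both `t` itself and deeper
    -- descendants.
    rcases hu with rfl | ⟨-, ⟨b, hb⟩ | hu⟩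
    · omega
    · exact ⟨b, t', hb, y, hys, K, hK⟩
    · omega

/-- A homeomorphism between the path spaces of two machines gives a bisimulation. -/
lemma exists_bisimulation (F : M.Paths ≃ₜ M'.Paths)
    (hlev : ∀ s t, M.label s = M'.label t → M.level s = M'.level t) :
    ∃ Z : σ → τ → Prop, Z M.root M'.root ∧ (∀ s t, Z s t → M.label s = M'.label t) ∧
      (∀ s t, Z s t → ∀ a s', M.child s a = some s' → ∃ b t', M'.child t b = some t' ∧ Z s' t') ∧
      ∀ s t, Z s t → ∀ b t', M'.child t b = some t' → ∃ a s', M.child s a = some s' ∧ Z s' t' := by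
  have hlabel : ∀ s t, (∃ x, StaysAt x s ∧ StaysAt (F x) t) → M.label s = M'.label t := by
    rintro s t ⟨x, hs, ht⟩
    obtain ⟨t₁, h₁, h₂⟩ := exists_staysAt ((hasLabel_iff F x _).2 hs.hasLabel)
    rw [← h₂, h₁.unique ht]
  refine ⟨fun s t => ∃ x, StaysAt x s ∧ StaysAt (F x) t, ?_, hlabel, ?_, ?_⟩
  · have hrun : ∀ n, M.run (fun _ => 0) n = main M.root := by
      intro n
      induction n with
      | zero => rfl
      | succ n ih => rw [run_succ, ih, step_zero]
    let x : M.Paths := ⟨fun _ => 0, (M.tree_iff _).2 fun n => by simp [hrun]⟩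
    have hx : StaysAt x M.root := ⟨0, fun n _ => hrun n⟩
    obtain ⟨t, ht, hl⟩ := exists_staysAt ((hasLabel_iff F x _).2 hx.hasLabel)
    refine ⟨x, hx, ?_⟩
    have h₁ := hlev _ _ hl.symm
    have h₂ := M.level_root
    have h₃ := M'.level_root
    obtain ⟨N, hN⟩ := ht
    -- The image rests at a state of level `0`, and no proper descendant of the root has that level.
    rcases run_main_of_le (M'.run_zero (F x).1) (Nat.zero_le N) with
      ⟨k, h⟩ | ⟨l, hl, h⟩ | ⟨u, h, hu⟩
    · simp [hN _ le_rfl] at h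
    · simp [hN _ le_rfl] at h
    · obtain rfl : t = u := by simpa [hN _ le_rfl] using h
      rcases hu with rfl | ⟨-, ⟨b, hb⟩ | hu⟩
      · exact ⟨N, hN⟩
      · have := M'.level_child _ _ _ hb
        omega
      · omega
  · rintro s t ⟨x, hs, ht⟩ a s' ha
    exact exists_child_of_homeomorph F hlev hs ht ha
  · rintro s t ⟨x, hs, ht⟩ b t' hb
    obtain ⟨a, s', ha, y, hy, hy'⟩ := exists_child_of_homeomorph F.symm
      (fun t s h => (hlev s t h.symm).symm) ht (by simpa using hs) hb
    exact ⟨a, s', ha, F.symm y, hy', by simpa using hy⟩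

end Bisimulation

end Machine

end UniformHomeo

namespace UniformHomeo

open Set Filter Topology

/-! ### Letter-by-letter translation between automata -/

section Transducer

variable {P Q : Type*} (f : P → ℕ → P) (g : Q → ℕ → Q) (e : P → Q → ℕ ≃ ℕ) (p₀ : P) (q₀ : Q)

/-- The pairs of states visited by two automata when the second one reads the letters of the first
one, translated by `e`. -/
def pairRun (x : ℕ → ℕ) : ℕ → P × Q
  | 0 => (p₀, q₀)
  | n + 1 => (f (pairRun x n).1 (x n),
      g (pairRun x n).2 (e (pairRun x n).1 (pairRun x n).2 (x n)))

/-- The letter-by-letter translation of a sequence. -/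
def translate (x : ℕ → ℕ) (n : ℕ) : ℕ :=
  e (pairRun f g e p₀ q₀ x n).1 (pairRun f g e p₀ q₀ x n).2 (x n)

lemma pairRun_congr {x y : ℕ → ℕ} {n : ℕ} (h : ∀ i < n, x i = y i) :
    pairRun f g e p₀ q₀ x n = pairRun f g e p₀ q₀ y n := by
  induction n with
  | zero => rfl
  | succ n ih => rw [pairRun, pairRun, ih fun i hi => h i (by omega), h n (by omega)]

lemma translate_congr {x y : ℕ → ℕ} {n : ℕ} (h : ∀ i < n, x i = y i) :
    ∀ i < n, translate f g e p₀ q₀ x i = translate f g e p₀ q₀ y i := by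
  intro i hi
  rw [translate, translate, pairRun_congr f g e p₀ q₀ fun j hj => h j (by omega), h i hi]

/-- Reading the translation with the inverse permutations visits the same pairs of states, so the
two translations undo each other. -/
lemma pairRun_translate (x : ℕ → ℕ) (n : ℕ) :
    pairRun g f (fun q p => (e p q).symm) q₀ p₀ (translate f g e p₀ q₀ x) n =
      (pairRun f g e p₀ q₀ x n).swap := by
  induction n with
  | zero => rfl
  | succ n ih => simp [pairRun, ih, translate]

lemma translate_translate (x : ℕ → ℕ) :
    translate g f (fun q p => (e p q).symm) q₀ p₀ (translate f g e p₀ q₀ x) = x := by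
  funext n
  rw [translate, pairRun_translate]
  simp [translate]

end Transducer

/-! ### From bisimulations to uniform homeomorphisms -/

namespace Machine

open Node

variable {σ τ : Type} {M : Machine σ} {M' : Machine τ}

lemma pairRun_fst (e : Node σ → Node τ → ℕ ≃ ℕ) (x : ℕ → ℕ) (n : ℕ) :
    (pairRun M.step M'.step e (main M.root) (main M'.root) x n).1 = M.run x n := by
  induction n with
  | zero => rfl
  | succ n ih => simp [pairRun, ih, run_succ]

lemma pairRun_snd (e : Node σ → Node τ → ℕ ≃ ℕ) (x : ℕ → ℕ) (n : ℕ) :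
    (pairRun M.step M'.step e (main M.root) (main M'.root) x n).2 =
      M'.run (translate M.step M'.step e (main M.root) (main M'.root) x) n := by
  rw [← pairRun_fst (M' := M) (fun q p => (e p q).symm), pairRun_translate]
  rfl

/-- The extension of a relation between the states of two machines to the nodes of the trees. -/
inductive NodeRel (Z : σ → τ → Prop) : Node σ → Node τ → Prop
  | dead : NodeRel Z dead dead
  | scat (k : ℕ) : NodeRel Z (scat k) (scat k)
  | gad (l : ℕ) : NodeRel Z (gad l) (gad l)
  | main {s : σ} {t : τ} : Z s t → NodeRel Z (main s) (main t)

lemma NodeRel.eq_dead_iff {Z : σ → τ → Prop} {p : Node σ} {q : Node τ} (h : NodeRel Z p q) :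
    p = Node.dead ↔ q = Node.dead := by
  cases h <;> simp

/-- The permutation of the letters induced by a permutation of the indices of the children. -/
def shiftPerm (e : ℕ ≃ ℕ) : ℕ ≃ ℕ where
  toFun
    | 0 => 0
    | 1 => 1
    | 2 => 2
    | a + 3 => e a + 3
  invFun
    | 0 => 0
    | 1 => 1
    | 2 => 2
    | a + 3 => e.symm a + 3
  left_inv a := by rcases a with _ | _ | _ | a <;> simp
  right_inv a := by rcases a with _ | _ | _ | a <;> simp

lemma exists_perm_of_nodeRel {Z : σ → τ → Prop} (hlab : ∀ s t, Z s t → M.label s = M'.label t)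
    (hZ : ∀ s t, Z s t → ∃ e : ℕ ≃ ℕ, ∀ a, Option.Rel Z (M.child s a) (M'.child t (e a)))
    {p : Node σ} {q : Node τ} (h : NodeRel Z p q) :
    ∃ e : ℕ ≃ ℕ, ∀ a, NodeRel Z (M.step p a) (M'.step q (e a)) := by
  rcases h with _ | k | l | @⟨s, t, hst⟩
  · exact ⟨.refl _, fun a => .dead⟩
  · refine ⟨.refl _, fun a => ?_⟩
    rcases k with _ | k <;> rcases a with _ | _ | a <;> constructor
  · refine ⟨.refl _, fun a => ?_⟩
    rcases a with _ | _ | _ | a <;> constructor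
  · obtain ⟨e, he⟩ := hZ s t hst
    refine ⟨shiftPerm e, fun a => ?_⟩
    rcases a with _ | _ | _ | a
    · exact .main hst
    · simp only [shiftPerm, Equiv.coe_fn_mk, step, hlab s t hst]
      exact .gad _
    · exact .gad _
    · simp only [shiftPerm, Equiv.coe_fn_mk, step]
      have h := he a
      generalize M.child s a = o at h ⊢
      generalize M'.child t (e a) = o' at h ⊢
      cases h with
      | some h => exact .main h
      | none => exact .dead

/-- A bisimulation that matches children by permutations of their indices gives a uniform
homeomorphism of the path spaces. -/
lemma congU_of_bisimulation (Z : σ → τ → Prop) (hroot : Z M.root M'.root)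
    (hlab : ∀ s t, Z s t → M.label s = M'.label t)
    (hZ : ∀ s t, Z s t → ∃ e : ℕ ≃ ℕ, ∀ a, Option.Rel Z (M.child s a) (M'.child t (e a))) :
    CongU M.tree M'.tree := by
  -- Unrelated pairs get the identity as a default, so that translation is defined on all sequences,
  -- not only on paths.
  have hex : ∀ p q, ∃ e : ℕ ≃ ℕ, NodeRel Z p q → ∀ a, NodeRel Z (M.step p a) (M'.step q (e a)) := by
    intro p q
    by_cases h : NodeRel Z p q
    · obtain ⟨e, he⟩ := exists_perm_of_nodeRel hlab hZ h
      exact ⟨e, fun _ => he⟩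
    · exact ⟨.refl _, fun h' => absurd h' h⟩
  choose e he using hex
  let F := translate M.step M'.step e (main M.root) (main M'.root)
  let G := translate M'.step M.step (fun q p => (e p q).symm) (main M'.root) (main M.root)
  have hGF : ∀ x, G (F x) = x := translate_translate _ _ _ _ _
  have hFG : ∀ y, F (G y) = y :=
    translate_translate M'.step M.step (fun q p => (e p q).symm) (main M'.root) (main M.root)
  have hrel : ∀ x n, NodeRel Z (M.run x n) (M'.run (F x) n) := by
    intro x n
    rw [← pairRun_fst (M' := M') e, ← pairRun_snd]
    induction n with
    | zero => exact .main hroot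
    | succ n ih => exact he _ _ ih _
  have halive : ∀ x, (∀ n, M.run x n ≠ dead) ↔ ∀ n, M'.run (F x) n ≠ dead :=
    fun x => forall_congr' fun n => not_congr (hrel x n).eq_dead_iff
  refine ⟨⟨⟨fun x => ⟨F x.1, (M'.tree_iff _).2 ((halive _).1 ((M.tree_iff _).1 x.2))⟩,
    fun y => ⟨G y.1, (M.tree_iff _).2 ((halive _).2 ?_)⟩, fun x => Subtype.ext (hGF _),
    fun y => Subtype.ext (hFG _)⟩, ?_, ?_⟩⟩
  · rw [hFG]
    exact (M'.tree_iff _).1 y.2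
  · exact PathSpace.uniformContinuous_iff.2 fun n => ⟨n, fun x y h => translate_congr _ _ _ _ _ h⟩
  · exact PathSpace.uniformContinuous_iff.2 fun n => ⟨n, fun x y h =>
      translate_congr M'.step M.step (fun q p => (e p q).symm) _ _ h⟩

/-- The tree of a machine depends continuously on parameters. -/
lemma continuous_tree {X : Type*} [TopologicalSpace X] (N : X → Machine σ)
    (hroot : ∀ x y, (N x).root = (N y).root)
    (hlab : ∀ s, IsLocallyConstant fun x => (N x).label s)
    (hchild : ∀ s a, IsLocallyConstant fun x => (N x).child s a) :
    Continuous fun x => (N x).tree := by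
  have hstep : ∀ p a, IsLocallyConstant fun x => (N x).step p a := by
    intro p a
    rcases p with _ | k | l | s
    · exact IsLocallyConstant.const _
    · rcases k with _ | k <;> rcases a with _ | _ | a <;> exact IsLocallyConstant.const _
    · rcases a with _ | _ | _ | a <;> exact IsLocallyConstant.const _
    · rcases a with _ | _ | _ | a
      · exact IsLocallyConstant.const _
      · exact (hlab s).comp Node.gad
      · exact IsLocallyConstant.const _
      · exact (hchild s a).comp fun o => o.elim dead main
  have hrun : ∀ w, IsLocallyConstant fun x => (N x).runList w := by
    intro w
    induction w using List.reverseRecOn with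
    | nil =>
      refine IsLocallyConstant.iff_eventually_eq _ |>.2 fun x => .of_forall fun y => ?_
      simp [runList, hroot y x]
    | append_singleton w a ih =>
      refine IsLocallyConstant.iff_eventually_eq _ |>.2 fun x => ?_
      filter_upwards [(IsLocallyConstant.iff_eventually_eq _).1 ih x,
        (IsLocallyConstant.iff_eventually_eq _).1 (hstep ((N x).runList w) a) x] with y h₁ h₂
      simp only [runList, List.foldl_append, List.foldl_cons, List.foldl_nil] at h₁ h₂ ⊢
      rw [h₁, h₂]
  exact Continuous.subtype_mk (continuous_pi fun w => ((hrun w).comp Node.alive).continuous) _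

end Machine

end UniformHomeo

namespace UniformHomeo

open Set Filter Topology

/-! ### Back-and-forth construction of a permutation -/

section BackAndForth

lemma exists_equiv_of_back_and_forth (P : List (ℕ × ℕ) → Prop) (hnil : P [])
    (forth : ∀ l, P l → ∀ a, ∃ b, P ((a, b) :: l)) (back : ∀ l, P l → ∀ b, ∃ a, P ((a, b) :: l))
    (hP : ∀ l, P l → ∀ p ∈ l, ∀ q ∈ l, p.1 = q.1 ↔ p.2 = q.2) :
    ∃ e : ℕ ≃ ℕ, ∀ i j, ∃ l, P l ∧ (i, e i) ∈ l ∧ (j, e j) ∈ l := by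
  have hnext : ∀ (n : ℕ) (l : {l // P l}), ∃ l' : {l // P l}, (∀ p ∈ l.1, p ∈ l'.1) ∧
      (∃ b, (n, b) ∈ l'.1) ∧ ∃ a, (a, n) ∈ l'.1 := by
    rintro n ⟨l, hl⟩
    obtain ⟨b, hb⟩ := forth l hl n
    obtain ⟨a, ha⟩ := back _ hb n
    exact ⟨⟨_, ha⟩, fun p hp => by simp [hp], ⟨b, by simp⟩, a, by simp⟩
  choose next hsub hfst hsnd using hnext
  let L : ℕ → {l // P l} := fun n => Nat.rec ⟨[], hnil⟩ next n
  have hmono : ∀ m n, m ≤ n → ∀ p ∈ (L m).1, p ∈ (L n).1 := by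
    intro m n h
    induction n, h using Nat.le_induction with
    | base => exact fun p hp => hp
    | succ n _ ih => exact fun p hp => hsub n (L n) p (ih p hp)
  have hf : ∀ n, ∃ b, (n, b) ∈ (L (n + 1)).1 := fun n => hfst n (L n)
  have hg : ∀ n, ∃ a, (a, n) ∈ (L (n + 1)).1 := fun n => hsnd n (L n)
  have hpair : ∀ m n p q, p ∈ (L m).1 → q ∈ (L n).1 → (p.1 = q.1 ↔ p.2 = q.2) := by
    intro m n p q hp hq
    exact hP _ (L (max m n)).2 p (hmono _ _ (le_max_left _ _) p hp) q
      (hmono _ _ (le_max_right _ _) q hq)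
  choose f hf using hf
  choose g hg using hg
  refine ⟨⟨f, g, fun n => ?_, fun n => ?_⟩, fun i j => ?_⟩
  · exact (hpair (f n + 1) (n + 1) (g (f n), f n) (n, f n) (hg (f n)) (hf n)).2 rfl
  · exact (hpair (g n + 1) (n + 1) (g n, f (g n)) (g n, n) (hf (g n)) (hg n)).1 rfl
  · exact ⟨_, (L (max (i + 1) (j + 1))).2, hmono _ _ (le_max_left _ _) _ (hf i),
      hmono _ _ (le_max_right _ _) _ (hf j)⟩

end BackAndForth

/-! ### Reducing graph isomorphism -/

section Graphs

/-- The equality and adjacency pattern of a vertex over a tuple. -/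
def patternOver (G : GraphOnNat) (a : ℕ) (s : List ℕ) : List (Bool × Bool) :=
  s.map fun b => (decide (a = b), G.1 (a, b))

/-- A code of the atomic type of a tuple of vertices. -/
def atomicType (G : GraphOnNat) : List ℕ → ℕ
  | [] => 1
  | a :: s => Nat.pair (atomicType G s) (Encodable.encode (patternOver G a s)) + 1

lemma atomicType_pos (G : GraphOnNat) (s : List ℕ) : 0 < atomicType G s := by
  cases s <;> simp [atomicType]

lemma atomicType_lt_cons (G : GraphOnNat) (a : ℕ) (s : List ℕ) :
    atomicType G s < atomicType G (a :: s) :=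
  Nat.lt_succ_of_le (Nat.left_le_pair _ _)

/-- The empty tuple has code `1` and longer ones have larger codes, so peeling off one vertex at a
time compares lengths. This is what lets labels determine levels. -/
lemma length_eq_of_atomicType_eq (G H : GraphOnNat) :
    ∀ s t, atomicType G s = atomicType H t → s.length = t.length := by
  intro s
  induction s with
  | nil =>
    rintro (_ | ⟨b, t⟩) h
    · rfl
    · have h₁ := atomicType_lt_cons H b t
      have h₂ := atomicType_pos H t
      rw [← h] at h₁
      simp only [atomicType] at h₁
      omega
  | cons a s ih =>
    rintro (_ | ⟨b, t⟩) h
    · have h₁ := atomicType_lt_cons G a s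
      have h₂ := atomicType_pos G s
      rw [h] at h₁
      simp only [atomicType] at h₁
      omega
    · simp only [atomicType, add_left_inj, Nat.pair_eq_pair] at h
      simp [ih t h.1]

lemma atomicType_map {G H : GraphOnNat} (e : ℕ ≃ ℕ) (he : ∀ i j, G.1 (i, j) = H.1 (e i, e j))
    (s : List ℕ) : atomicType G s = atomicType H (s.map e) := by
  induction s with
  | nil => rfl
  | cons a s ih => simp [atomicType, patternOver, ih, he, Function.comp_def]

lemma pattern_of_atomicType_eq {G H : GraphOnNat} (l : List (ℕ × ℕ))
    (h : atomicType G (l.map Prod.fst) = atomicType H (l.map Prod.snd)) :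
    ∀ p ∈ l, ∀ q ∈ l, (p.1 = q.1 ↔ p.2 = q.2) ∧ G.1 (p.1, q.1) = H.1 (p.2, q.2) := by
  induction l with
  | nil => simp
  | cons r l ih =>
    simp only [List.map_cons, atomicType, add_left_inj, Nat.pair_eq_pair,
      Encodable.encode_inj, patternOver, List.map_map, List.map_inj_left, Function.comp_apply,
      Prod.mk.injEq, decide_eq_decide] at h
    obtain ⟨h₁, h₂⟩ := h
    intro p hp q hq
    rcases List.mem_cons.1 hp with rfl | hp' <;> rcases List.mem_cons.1 hq with rfl | hq'
    · simp [G.2.2, H.2.2]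
    · exact h₂ q hq'
    · rw [G.2.1, H.2.1, eq_comm, @eq_comm _ p.2]
      exact h₂ p hp'
    · exact ih h₁ p hp' q hq'

/-- The machine whose states are the tuples of vertices of a graph. -/
def graphMachine (G : GraphOnNat) : Machine (List ℕ) where
  label := atomicType G
  level := List.length
  child s a := some (a :: s)
  root := []
  label_pos := atomicType_pos G
  level_root := rfl
  label_lt := by
    rintro s a _ ⟨⟩
    exact atomicType_lt_cons G a s
  level_child := by
    rintro s a _ ⟨⟩
    rfl

lemma gi_iff (G H : GraphOnNat) :
    GI G H ↔ ∃ e : ℕ ≃ ℕ, ∀ i j, G.1 (i, j) = H.1 (e i, e j) := by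
  constructor
  · rintro ⟨e⟩
    exact ⟨e.toEquiv, fun i j => Bool.eq_iff_iff.2 (e.map_rel_iff (a := i) (b := j)).symm⟩
  · rintro ⟨e, he⟩
    exact ⟨⟨e, fun {i j} => Bool.eq_iff_iff.1 (he i j).symm⟩⟩

/-- Every vertex indexes a child of every tuple, so the two bisimulation conditions are forth and
back, and equal labels make the matched tuples partial isomorphisms. -/
lemma congU_graphMachine_iff (G H : GraphOnNat) :
    CongU (graphMachine G).tree (graphMachine H).tree ↔ GI G H := by
  rw [gi_iff]
  constructor
  · rintro ⟨F⟩
    obtain ⟨Z, hroot, hlab, forth, back⟩ := Machine.exists_bisimulation F.toHomeomorph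
      (length_eq_of_atomicType_eq G H)
    have hP := fun (l : List (ℕ × ℕ)) (h : Z (l.map Prod.fst) (l.map Prod.snd)) =>
      pattern_of_atomicType_eq l (hlab _ _ h)
    obtain ⟨e, he⟩ := exists_equiv_of_back_and_forth
      (fun l => Z (l.map Prod.fst) (l.map Prod.snd)) hroot
      (fun l hl a => by
        obtain ⟨b, t', hb, hZ⟩ := forth _ _ hl a _ rfl
        obtain rfl := Option.some_injective _ hb
        exact ⟨b, hZ⟩)
      (fun l hl b => by
        obtain ⟨a, s', ha, hZ⟩ := back _ _ hl b _ rfl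
        obtain rfl := Option.some_injective _ ha
        exact ⟨a, hZ⟩)
      (fun l hl p hp q hq => (hP l hl p hp q hq).1)
    refine ⟨e, fun i j => ?_⟩
    obtain ⟨l, hl, hi, hj⟩ := he i j
    exact (hP l hl _ hi _ hj).2
  · rintro ⟨e, he⟩
    refine Machine.congU_of_bisimulation (fun s t => t = s.map e) rfl ?_ ?_
    · rintro s _ rfl
      exact atomicType_map e he s
    · rintro s _ rfl
      exact ⟨e, fun a => .some rfl⟩

lemma isLocallyConstant_apply (p : ℕ × ℕ) : IsLocallyConstant fun G : GraphOnNat => G.1 p :=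
  IsLocallyConstant.iff_continuous _ |>.2 ((continuous_apply p).comp continuous_subtype_val)

lemma isLocallyConstant_patternOver (a : ℕ) (s : List ℕ) :
    IsLocallyConstant fun G : GraphOnNat => patternOver G a s := by
  induction s with
  | nil => exact IsLocallyConstant.const _
  | cons b s ih =>
    exact (isLocallyConstant_apply (a, b)).comp₂ ih fun x l => (decide (a = b), x) :: l

lemma isLocallyConstant_atomicType (s : List ℕ) :
    IsLocallyConstant fun G : GraphOnNat => atomicType G s := by
  induction s with
  | nil => exact IsLocallyConstant.const _
  | cons a s ih =>
    exact ih.comp₂ (isLocallyConstant_patternOver a s) fun k l => Nat.pair k (Encodable.encode l) + 1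

lemma borelReducible_gi_congU : BorelReducible GI CongU := by
  refine ⟨fun G => (graphMachine G).tree, ?_, fun G H => (congU_graphMachine_iff G H).symm⟩
  exact (Machine.continuous_tree graphMachine (fun _ _ => rfl) isLocallyConstant_atomicType
    fun _ _ => IsLocallyConstant.const _).measurable

end Graphs

end UniformHomeo

namespace UniformHomeo

open Set Filter Topology MeasureTheory

/-! ### The Kleene-Brouwer order and infinite branches -/

section KleeneBrouwer

/-- The Kleene-Brouwer order on finite sequences. -/
def kb : List ℕ → List ℕ → Prop
  | [], _ => False
  | _ :: _, [] => True
  | a :: s, b :: t => a < b ∨ a = b ∧ kb s t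

lemma not_kb_nil (t : List ℕ) : ¬ kb [] t := by simp [kb]

lemma kb_trichotomous : ∀ s t, kb s t ∨ s = t ∨ kb t s := by
  intro s
  induction s with
  | nil => rintro (_ | ⟨b, t⟩) <;> simp [kb]
  | cons a s ih =>
    rintro (_ | ⟨b, t⟩)
    · simp [kb]
    · have := ih t
      simp only [kb, List.cons.injEq]
      rcases lt_trichotomy a b with h | rfl | h
      · exact .inl (.inl h)
      · simpa using this
      · exact .inr (.inr (.inl h))

lemma kb_append_singleton (s : List ℕ) (a : ℕ) : kb (s ++ [a]) s := by
  induction s with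
  | nil => trivial
  | cons b s ih => exact .inr ⟨rfl, ih⟩

/-- The Kleene-Brouwer order with smaller elements restricted to a set. -/
def kbRel (A : Set (List ℕ)) (v u : List ℕ) : Prop := v ∈ A ∧ kb v u

/-- Induction on the first letter, and within a fixed first letter on the accessibility of the
remainder. The empty sequence lies above all others. -/
lemma acc_kbRel_of_forall {A : Set (List ℕ)}
    (h : ∀ a u, a :: u ∈ A → Acc (kbRel {u | a :: u ∈ A}) u) : ∀ w ∈ A, Acc (kbRel A) w := by
  have hcons : ∀ a u, a :: u ∈ A → Acc (kbRel A) (a :: u) := by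
    intro a
    induction a using Nat.strong_induction_on with
    | _ a ih =>
      intro u hu
      have hacc := h a u hu
      induction hacc with
      | intro u _ ihu =>
        refine ⟨_, ?_⟩
        rintro (_ | ⟨b, v⟩) ⟨hv, hlt⟩
        · exact (not_kb_nil _ hlt).elim
        · rcases hlt with hlt | ⟨rfl, hlt⟩
          · exact ih b hlt v hv
          · exact ihu v ⟨hv, hlt⟩ hv
  rintro (_ | ⟨a, u⟩) hw
  · refine ⟨_, ?_⟩
    rintro (_ | ⟨b, v⟩) ⟨hv, hlt⟩
    · exact (not_kb_nil _ hlt).elim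
    · exact hcons b v hv
  · exact hcons a u hw

/-- A set of finite sequences has an infinite branch. -/
def HasBranch (T : Set (List ℕ)) : Prop := ∃ z : ℕ → ℕ, ∀ n, (List.range n).map z ∈ T

lemma acc_kbRel_of_not_hasBranch {T : Set (List ℕ)} (hT : ∀ s t, s <+: t → t ∈ T → s ∈ T)
    (hb : ¬ HasBranch T) : ∀ w ∈ T, Acc (kbRel T) w := by
  by_contra hcon
  apply hb
  -- A failure of accessibility above `l` persists above some one-letter extension of `l`; iterating
  -- traces out a branch.
  let P : List ℕ → Prop := fun l => ¬ ∀ u, l ++ u ∈ T → Acc (kbRel {u | l ++ u ∈ T}) u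
  have hnext : ∀ l : {l // P l}, ∃ a, P (l.1 ++ [a]) := by
    rintro ⟨l, hl⟩
    by_contra hP
    simp only [P, not_exists, not_not, List.append_assoc, List.singleton_append] at hP
    exact hl (acc_kbRel_of_forall (A := {u | l ++ u ∈ T}) hP)
  choose a ha using hnext
  let L : ℕ → {l // P l} := fun n => Nat.rec ⟨[], hcon⟩ (fun _ l => ⟨l.1 ++ [a l], ha l⟩) n
  have hL : ∀ n, (List.range n).map (fun n => a (L n)) = (L n).1 := by
    intro n
    induction n with
    | zero => rfl
    | succ n ih => rw [List.range_succ, List.map_append, ih]; rfl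
  refine ⟨fun n => a (L n), fun n => ?_⟩
  rw [hL]
  by_contra hn
  exact (L n).2 fun u hu => (hn (hT _ _ ⟨u, rfl⟩ hu)).elim

end KleeneBrouwer

/-! ### Machines of descending sequences -/

section DescendingSequences

/-- An enumeration of finite sequences and a further object, each repeated infinitely often. -/
noncomputable def letterEquiv : ℕ ≃ Option (List ℕ) × ℕ := (Denumerable.eqv _).symm

open Classical in
/-- The machine whose runs are the Kleene-Brouwer descending sequences in a set. -/
noncomputable def descMachine (A : Set (List ℕ)) : Machine (ℕ × List ℕ) where
  label s := s.1 + 1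
  level s := s.1
  child s a := (letterEquiv a).1.bind fun v => if kbRel A v s.2 then some (s.1 + 1, v) else none
  root := (0, [])
  label_pos _ := Nat.succ_pos _
  level_root := rfl
  label_lt := by
    intro s a t h
    obtain ⟨v, -, h⟩ := Option.bind_eq_some_iff.1 h
    split_ifs at h
    cases h
    exact Nat.lt_succ_self _
  level_child := by
    intro s a t h
    obtain ⟨v, -, h⟩ := Option.bind_eq_some_iff.1 h
    split_ifs at h
    cases h
    rfl

lemma descMachine_child_eq_some {A : Set (List ℕ)} {s t : ℕ × List ℕ} {a : ℕ} :
    (descMachine A).child s a = some t ↔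
      (letterEquiv a).1 = some t.2 ∧ t.1 = s.1 + 1 ∧ kbRel A t.2 s.2 := by
  obtain ⟨n, v⟩ := t
  simp only [descMachine, Option.bind_eq_some_iff]
  constructor
  · rintro ⟨u, hu, h⟩
    split_ifs at h with hk
    cases h
    exact ⟨hu, rfl, hk⟩
  · rintro ⟨hu, rfl, hk⟩
    exact ⟨v, hu, by simp [hk]⟩

lemma exists_child {A : Set (List ℕ)} (n : ℕ) {u v : List ℕ} (h : kbRel A v u) :
    ∃ a, (descMachine A).child (n, u) a = some (n + 1, v) :=
  ⟨letterEquiv.symm (some v, 0), descMachine_child_eq_some.2 ⟨by simp, rfl, h⟩⟩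

/-- Labels show only the length of a sequence, but a bisimulation still matches every descent in `B`
by a descent in `A`, so well-foundedness transfers. -/
lemma acc_of_congU {A B : Set (List ℕ)} (h : CongU (descMachine A).tree (descMachine B).tree)
    (hA : Acc (kbRel A) []) : Acc (kbRel B) [] := by
  obtain ⟨F⟩ := h
  obtain ⟨Z, hroot, -, -, back⟩ := Machine.exists_bisimulation F.toHomeomorph
    (fun s t h => Nat.succ_injective h)
  have key : ∀ u, Acc (kbRel A) u → ∀ n n' u', Z (n, u) (n', u') → Acc (kbRel B) u' := by
    intro u hu
    induction hu with
    | intro u _ ih =>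
      intro n n' u' hZ
      refine ⟨_, fun v hv => ?_⟩
      obtain ⟨b, hb⟩ := exists_child n' hv
      obtain ⟨a, s', ha, hZ'⟩ := back _ _ hZ b _ hb
      exact ih s'.2 (descMachine_child_eq_some.1 ha).2.2 s'.1 _ v hZ'
  exact key _ hA _ _ _ hroot

/-- All nonempty fibers are countably infinite, so they can be matched one by one. This is why
`letterEquiv` repeats every child infinitely often. -/
lemma exists_equiv_of_fibers {Θ : Type*} (f g : ℕ → Θ) (hf : ∀ a, {b | f b = f a}.Infinite)
    (hg : ∀ a, {b | g b = g a}.Infinite) (hfg : range f = range g) :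
    ∃ e : ℕ ≃ ℕ, ∀ a, f a = g (e a) := by
  have hE : ∀ θ, Nonempty ({a // f a = θ} ≃ {b // g b = θ}) := by
    intro θ
    by_cases h : θ ∈ range f
    · obtain ⟨a, rfl⟩ := h
      obtain ⟨b, hb⟩ : f a ∈ range g := hfg ▸ mem_range_self a
      have : Infinite {a' // f a' = f a} := (hf a).to_subtype
      have : Infinite {b' // g b' = f a} := hb ▸ (hg b).to_subtype
      exact nonempty_equiv_of_countable
    · have h' : θ ∉ range g := hfg ▸ h
      have : IsEmpty {a // f a = θ} := ⟨fun a => h ⟨a.1, a.2⟩⟩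
      have : IsEmpty {b // g b = θ} := ⟨fun b => h' ⟨b.1, b.2⟩⟩
      exact ⟨Equiv.equivOfIsEmpty _ _⟩
  refine ⟨(Equiv.sigmaFiberEquiv f).symm.trans
    ((Equiv.sigmaCongrRight fun θ => Classical.choice (hE θ)).trans (Equiv.sigmaFiberEquiv g)),
    fun a => ?_⟩
  exact ((Classical.choice (hE (f a))) ⟨a, rfl⟩).2.symm

open Classical in
/-- An accessible element is its own type; the others have the same type. -/
noncomputable def accType (A : Set (List ℕ)) (u : List ℕ) : Option (List ℕ) :=
  if Acc (kbRel A) u then some u else none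

lemma accType_eq_some {A : Set (List ℕ)} {u v : List ℕ} :
    accType A u = some v ↔ u = v ∧ Acc (kbRel A) u := by
  simp only [accType, Option.ite_none_right_eq_some, Option.some_inj]
  exact and_comm

lemma accType_eq_none {A : Set (List ℕ)} {u : List ℕ} :
    accType A u = none ↔ ¬ Acc (kbRel A) u := by
  simp [accType]

/-- The type of the child with a given index. -/
noncomputable def childType (A : Set (List ℕ)) (s : ℕ × List ℕ) (a : ℕ) :
    Option (Option (List ℕ)) :=
  ((descMachine A).child s a).map fun t => accType A t.2

lemma infinite_childType (A : Set (List ℕ)) (s : ℕ × List ℕ) (a : ℕ) :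
    {b | childType A s b = childType A s a}.Infinite := by
  refine infinite_of_injective_forall_mem (f := fun m => letterEquiv.symm ((letterEquiv a).1, m))
    (fun m m' h => by simpa using h) fun m => ?_
  simp [childType, descMachine]

/-- An inaccessible element has an inaccessible element below it and, the order being total, every
accessible member of the set as well. So the types of its children do not depend on which
inaccessible element it is. -/
lemma range_childType_subset {A B : Set (List ℕ)}
    (hAB : ∀ u, u ∈ A → Acc (kbRel A) u → u ∈ B ∧ Acc (kbRel B) u) {n n' : ℕ} {u u' : List ℕ}
    (hu' : u' ∈ B ∨ u' = []) (h : accType A u = accType B u') :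
    range (childType A (n, u)) ⊆ range (childType B (n', u')) := by
  have hmem : ∀ {v}, kbRel B v u' → some (accType B v) ∈ range (childType B (n', u')) := by
    intro v hv
    obtain ⟨b, hb⟩ := exists_child n' hv
    exact ⟨b, by simp [childType, hb]⟩
  rintro _ ⟨a, rfl⟩
  rcases hc : (descMachine A).child (n, u) a with _ | ⟨m, v⟩
  · have h₀ : childType B (n', u') (letterEquiv.symm (none, 0)) = none := by
      simp [childType, descMachine]
    rw [childType, hc]
    exact ⟨_, h₀⟩
  obtain ⟨-, -, hv⟩ := descMachine_child_eq_some.1 hc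
  simp only [childType, hc, Option.map_some]
  by_cases hacc : Acc (kbRel A) v
  · obtain ⟨hvB, hvacc⟩ := hAB v hv.1 hacc
    have hk : kb v u' := by
      by_cases huacc : Acc (kbRel A) u
      · rw [accType_eq_some.2 ⟨rfl, huacc⟩] at h
        exact (accType_eq_some.1 h.symm).1 ▸ hv.2
      · rw [accType_eq_none.2 huacc] at h
        have hu := accType_eq_none.1 h.symm
        rcases kb_trichotomous v u' with h₁ | rfl | h₁
        · exact h₁
        · exact absurd hvacc hu
        · rcases hu' with hu' | rfl
          · exact absurd (hvacc.inv ⟨hu', h₁⟩) hu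
          · exact (not_kb_nil _ h₁).elim
    have := hmem ⟨hvB, hk⟩
    rwa [accType_eq_some.2 ⟨rfl, hvacc⟩, ← accType_eq_some.2 ⟨rfl, hacc⟩] at this
  · have hu : ¬ Acc (kbRel A) u := fun hu => hacc (hu.inv hv)
    rw [accType_eq_none.2 hu] at h
    obtain ⟨v', hv', hlt⟩ := exists_not_acc_lt_of_not_acc (accType_eq_none.1 h.symm)
    have := hmem hlt
    rwa [accType_eq_none.2 hv', ← accType_eq_none.2 hacc] at this

lemma congU_descMachine {A B : Set (List ℕ)}
    (hAB : ∀ u, u ∈ A ∧ Acc (kbRel A) u ↔ u ∈ B ∧ Acc (kbRel B) u)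
    (hA : ¬ Acc (kbRel A) []) (hB : ¬ Acc (kbRel B) []) :
    CongU (descMachine A).tree (descMachine B).tree := by
  refine Machine.congU_of_bisimulation (fun s t => s.1 = t.1 ∧ (s.2 ∈ A ∨ s.2 = []) ∧
    (t.2 ∈ B ∨ t.2 = []) ∧ accType A s.2 = accType B t.2) ?_ ?_ ?_
  · exact ⟨rfl, .inr rfl, .inr rfl, (accType_eq_none.2 hA).trans (accType_eq_none.2 hB).symm⟩
  · rintro s t ⟨h, -⟩
    exact congrArg (· + 1) h
  · rintro ⟨n, u⟩ ⟨n', u'⟩ ⟨h, hu, hu', htype⟩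
    obtain ⟨e, he⟩ := exists_equiv_of_fibers (childType A (n, u)) (childType B (n', u'))
      (infinite_childType _ _) (infinite_childType _ _)
      ((range_childType_subset (fun u h₁ h₂ => (hAB u).1 ⟨h₁, h₂⟩) hu' htype).antisymm
        (range_childType_subset (fun u h₁ h₂ => (hAB u).2 ⟨h₁, h₂⟩) hu htype.symm))
    refine ⟨e, fun a => ?_⟩
    have ha := he a
    rcases h₁ : (descMachine A).child (n, u) a with _ | t <;>
      rcases h₂ : (descMachine B).child (n', u') (e a) with _ | t' <;>
      simp only [childType, h₁, h₂, Option.map_none, Option.map_some, reduceCtorEq,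
        Option.some_inj] at ha
    · exact .none
    · obtain ⟨-, h₃, h₄⟩ := descMachine_child_eq_some.1 h₁
      obtain ⟨-, h₅, h₆⟩ := descMachine_child_eq_some.1 h₂
      exact .some ⟨by simp_all, .inl h₄.1, .inl h₆.1, ha⟩

/-- A copy of `T`. -/
def shifted (T : Set (List ℕ)) : Set (List ℕ) := {w | ∃ u ∈ T, w = 0 :: u}

/-- A copy of `T` below a descending sequence. -/
def shiftedBelow (T : Set (List ℕ)) : Set (List ℕ) :=
  shifted T ∪ {w | ∃ k, w = List.replicate (k + 1) 1}

lemma not_acc_replicate (T : Set (List ℕ)) (k : ℕ) :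
    ¬ Acc (kbRel (shiftedBelow T)) (List.replicate (k + 1) 1) := by
  intro h
  generalize hw : List.replicate (k + 1) 1 = w at h
  induction h generalizing k with
  | intro w _ ih =>
    refine ih (List.replicate (k + 1 + 1) 1) ⟨.inr ⟨k + 1, rfl⟩, ?_⟩ (k + 1) rfl
    rw [← hw, List.replicate_succ']
    exact kb_append_singleton _ _

/-- Sequences starting with `1` lie above those starting with `0`, so the added descending sequence
is invisible from the copy of `T`. -/
lemma acc_shifted_iff (T : Set (List ℕ)) (u : List ℕ) :
    Acc (kbRel (shiftedBelow T)) (0 :: u) ↔ Acc (kbRel (shifted T)) (0 :: u) := by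
  constructor
  · exact Subrelation.accessible fun h => ⟨.inl h.1, h.2⟩
  · intro h
    generalize hw : 0 :: u = w at h
    induction h generalizing u with
    | intro w _ ih =>
      refine ⟨_, ?_⟩
      rintro v ⟨⟨v, hv, rfl⟩ | ⟨k, rfl⟩, hlt⟩
      · exact ih _ ⟨⟨v, hv, rfl⟩, hlt⟩ v rfl
      · rw [← hw, List.replicate_succ] at hlt
        simp [kb] at hlt

lemma congU_iff_hasBranch {T : Set (List ℕ)} (hT : ∀ s t, s <+: t → t ∈ T → s ∈ T) :
    CongU (descMachine (shifted T)).tree (descMachine (shiftedBelow T)).tree ↔ HasBranch T := by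
  have hB : ¬ Acc (kbRel (shiftedBelow T)) [] := fun h =>
    not_acc_replicate T 0 (h.inv ⟨.inr ⟨0, rfl⟩, trivial⟩)
  constructor
  · intro h
    by_contra hb
    have hacc := acc_kbRel_of_not_hasBranch hT hb
    refine hB (acc_of_congU h ⟨_, fun v hv => acc_kbRel_of_forall ?_ v hv.1⟩)
    rintro a u ⟨_, hu, h⟩
    obtain ⟨rfl, rfl⟩ := List.cons.inj h
    have : {u | 0 :: u ∈ shifted T} = T := by
      ext u
      simp [shifted]
    rw [this]
    exact hacc u hu
  · rintro ⟨z, hz⟩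
    have hA : ∀ n, ¬ Acc (kbRel (shifted T)) (0 :: (List.range n).map z) := by
      intro n h
      generalize hw : 0 :: (List.range n).map z = w at h
      induction h generalizing n with
      | intro w _ ih =>
        refine ih _ ⟨⟨_, hz (n + 1), rfl⟩, ?_⟩ (n + 1) rfl
        rw [← hw, List.range_succ, List.map_append]
        exact .inr ⟨rfl, kb_append_singleton _ _⟩
    refine congU_descMachine (fun u => ?_)
      (fun h => hA 0 (h.inv ⟨⟨_, hz 0, rfl⟩, trivial⟩)) hB
    constructor
    · rintro ⟨⟨u, hu, rfl⟩, hacc⟩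
      exact ⟨.inl ⟨u, hu, rfl⟩, (acc_shifted_iff T u).2 hacc⟩
    · rintro ⟨⟨u, hu, rfl⟩ | ⟨k, rfl⟩, hacc⟩
      · exact ⟨⟨u, hu, rfl⟩, (acc_shifted_iff T u).1 hacc⟩
      · exact absurd hacc (not_acc_replicate T k)

lemma continuous_descMachine_tree {Y : Type*} [TopologicalSpace Y] (A : Y → Set (List ℕ))
    (hA : ∀ w, IsLocallyConstant fun y => w ∈ A y) :
    Continuous fun y => (descMachine (A y)).tree := by
  classical
  refine Machine.continuous_tree (fun y => descMachine (A y)) (fun _ _ => rfl)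
    (fun _ => IsLocallyConstant.const _) fun s a => ?_
  rcases h : (letterEquiv a).1 with _ | v
  · simp only [descMachine, h]
    exact IsLocallyConstant.const _
  · simp only [descMachine, h, kbRel]
    refine (IsLocallyConstant.iff_eventually_eq _).2 fun x => ?_
    filter_upwards [(IsLocallyConstant.iff_eventually_eq _).1 (hA v) x] with y hy
    simp only [Option.bind_some, hy]
    congr

lemma isLocallyConstant_shifted {Y : Type*} [TopologicalSpace Y] {T : Y → Set (List ℕ)}
    (hT : ∀ w, IsLocallyConstant fun y => w ∈ T y) (w : List ℕ) :
    IsLocallyConstant fun y => w ∈ shifted (T y) := by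
  rcases w with _ | ⟨_ | a, u⟩
  · simp only [shifted, mem_ofPred_eq, reduceCtorEq, and_false, exists_false]
    exact IsLocallyConstant.const False
  · simpa [shifted] using hT u
  · simp only [shifted, mem_ofPred_eq, List.cons.injEq, Nat.add_eq_zero_iff, one_ne_zero,
      and_false, false_and, exists_false]
    exact IsLocallyConstant.const False

lemma isLocallyConstant_shiftedBelow {Y : Type*} [TopologicalSpace Y] {T : Y → Set (List ℕ)}
    (hT : ∀ w, IsLocallyConstant fun y => w ∈ T y) (w : List ℕ) :
    IsLocallyConstant fun y => w ∈ shiftedBelow (T y) :=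
  (isLocallyConstant_shifted hT w).comp fun p : Prop => p ∨ ∃ k, w = List.replicate (k + 1) 1

end DescendingSequences

/-! ### Analytic sets as projections of trees -/

section AnalyticSets

lemma exists_forall_lt_imp_mem {U : Set (ℕ → ℕ)} (hU : IsOpen U) {z : ℕ → ℕ} (hz : z ∈ U) :
    ∃ N, ∀ z' : ℕ → ℕ, (∀ i < N, z' i = z i) → z' ∈ U := by
  obtain ⟨_, ⟨x, N, rfl⟩, hx, hsub⟩ :=
    (PiNat.isTopologicalBasis_cylinders fun _ => ℕ).exists_subset_of_mem_open hz hU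
  refine ⟨N, fun z' h => hsub ?_⟩
  rw [PiNat.mem_cylinder_iff] at hx ⊢
  exact fun i hi => (h i hi).trans (hx i hi)

/-- An analytic set in a zero-dimensional space is the set of parameters for which a continuously
parametrized tree has an infinite branch. -/
lemma exists_trees_of_analyticSet {Y : Type*} [TopologicalSpace Y] [T2Space Y]
    [SecondCountableTopology Y] (hY : TopologicalSpace.IsTopologicalBasis {U : Set Y | IsClopen U})
    {B : Set Y} (hB : AnalyticSet B) :
    ∃ T : Y → Set (List ℕ), (∀ w, IsLocallyConstant fun y => w ∈ T y) ∧
      (∀ y s t, s <+: t → t ∈ T y → s ∈ T y) ∧ ∀ y, y ∈ B ↔ HasBranch (T y) := by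
  rw [analyticSet_iff_exists_polishSpace_range] at hB
  by_cases hne : B = ∅
  · refine ⟨fun _ => ∅, fun w => IsLocallyConstant.const (w ∈ (∅ : Set (List ℕ))), by simp, fun y => ?_⟩
    simp [hne, HasBranch]
  replace hB : ∃ h : (ℕ → ℕ) → Y, Continuous h ∧ range h = B := by
    rw [← analyticSet_iff_exists_polishSpace_range, AnalyticSet] at hB
    exact hB.resolve_left hne
  obtain ⟨h, hh, rfl⟩ := hB
  obtain ⟨s, hs, hsc, hsb⟩ := hY.exists_countable
  have hsne : s.Nonempty := by
    obtain ⟨U, hU, -⟩ := hsb.exists_subset_of_mem_open (mem_univ (h 0)) isOpen_univ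
    exact ⟨U, hU⟩
  obtain ⟨C, rfl⟩ := hsc.exists_eq_range hsne
  have hC : ∀ i, IsClopen (C i) := fun i => hs (mem_range_self i)
  -- A word survives if some `z` extending it has `h z` agreeing with `y` on the first `w.length`
  -- basic clopen sets. Finitely many clopen conditions make this locally constant in `y`, and along
  -- a branch `z` continuity of `h` forces `h z = y`.
  refine ⟨fun y => {w | ∃ z : ℕ → ℕ, (List.range w.length).map z = w ∧
    ∀ i < w.length, h z ∈ C i ↔ y ∈ C i}, fun w => ?_, ?_, fun y => ?_⟩
  · rw [IsLocallyConstant.iff_eventually_eq]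
    intro y
    have hev : ∀ i ∈ Finset.range w.length, ∀ᶠ y' in 𝓝 y, (y' ∈ C i ↔ y ∈ C i) := by
      intro i _
      by_cases hy : y ∈ C i
      · filter_upwards [(hC i).isOpen.mem_nhds hy] with y' hy'
        simp [hy, hy']
      · filter_upwards [(hC i).compl.isOpen.mem_nhds hy] with y' hy'
        simpa [hy] using hy'
    filter_upwards [(Finset.eventually_all _).2 hev] with y' hy'
    simp only [Finset.mem_range] at hy'
    simp only [eq_iff_iff]
    refine exists_congr fun z => and_congr_right fun _ => ?_
    exact forall₂_congr fun i hi => by rw [hy' i hi]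
  · rintro y s _ ⟨u, rfl⟩ ⟨z, hz, hzC⟩
    refine ⟨z, ?_, fun i hi => hzC i (by simp; omega)⟩
    rw [List.length_append, List.range_add, List.map_append] at hz
    exact List.append_inj_left hz (by simp)
  · constructor
    · rintro ⟨z, rfl⟩
      exact ⟨z, fun n => ⟨z, by simp, by simp⟩⟩
    · rintro ⟨z, hz⟩
      refine ⟨z, ?_⟩
      by_contra hne
      obtain ⟨_, ⟨i, rfl⟩, hi, hsub⟩ := hsb.exists_subset_of_mem_open
        (show h z ∈ ({y}ᶜ : Set Y) from hne) isOpen_compl_singleton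
      obtain ⟨N, hN⟩ := exists_forall_lt_imp_mem ((hC i).isOpen.preimage hh) hi
      obtain ⟨z', hz', hz'C⟩ := hz (max N (i + 1))
      simp only [List.length_map, List.length_range, List.map_inj_left, List.mem_range] at hz' hz'C
      have h₁ := hN z' fun j hj => hz' j (hj.trans_le (le_max_left _ _))
      exact hsub ((hz'C i (lt_of_lt_of_le (Nat.lt_succ_self i) (le_max_right _ _))).1 h₁) rfl

lemma exists_continuous_preimage_congU {Y : Type*} [TopologicalSpace Y] [T2Space Y]
    [SecondCountableTopology Y] (hY : TopologicalSpace.IsTopologicalBasis {U : Set Y | IsClopen U})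
    {B : Set Y} (hB : AnalyticSet B) :
    ∃ f : Y → PrunedTree × PrunedTree, Continuous f ∧ f ⁻¹' {p | CongU p.1 p.2} = B := by
  obtain ⟨T, hT, hpre, hbr⟩ := exists_trees_of_analyticSet hY hB
  refine ⟨fun y => ((descMachine (shifted (T y))).tree, (descMachine (shiftedBelow (T y))).tree),
    (continuous_descMachine_tree _ (isLocallyConstant_shifted hT)).prodMk
      (continuous_descMachine_tree _ (isLocallyConstant_shiftedBelow hT)), ?_⟩
  ext y
  rw [hbr]
  exact congU_iff_hasBranch (hpre y)

end AnalyticSets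

end UniformHomeo

namespace UniformHomeo

open Set Filter Topology MeasureTheory

/-! ### Coding uniform homeomorphisms by maps of trees -/

section Codes

/-- The node of `ℕ^{<ℕ}` coded by the value of `f` at `s`. -/
def decodeAt (f : List ℕ → ℕ) (s : List ℕ) : List ℕ := (Denumerable.eqv (List ℕ)).symm (f s)

/-- `f` codes a uniformly continuous map of path spaces. -/
def CodesMap (S T : List ℕ → Bool) (f : List ℕ → ℕ) : Prop :=
  (∀ s, S s = true → T (decodeAt f s) = true) ∧
    (∀ s s', S s' = true → s <+: s' → decodeAt f s <+: decodeAt f s') ∧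
    ∀ n, ∃ k, ∀ s, S s = true → k ≤ s.length → n ≤ (decodeAt f s).length

/-- The maps coded by `f` and `g` are inverse on one side. -/
def CodesLeftInverse (S : List ℕ → Bool) (f g : List ℕ → ℕ) : Prop :=
  ∀ s, S s = true → decodeAt g (decodeAt f s) <+: s ∨ s <+: decodeAt g (decodeAt f s)

/-- `f` and `g` code mutually inverse uniform homeomorphisms of path spaces. -/
def CodesEquiv (S T : List ℕ → Bool) (f g : List ℕ → ℕ) : Prop :=
  CodesMap S T f ∧ CodesMap T S g ∧ CodesLeftInverse S f g ∧ CodesLeftInverse T g f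

variable {S T : PrunedTree}

/-- The initial segment of length `n`. -/
def PathSpace.init (x : PathSpace T) (n : ℕ) : List ℕ := (List.range n).map x.1

@[simp] lemma PathSpace.length_init (x : PathSpace T) (n : ℕ) : (x.init n).length = n := by
  simp [PathSpace.init]

lemma PathSpace.init_eq_iff {x y : PathSpace T} {n : ℕ} :
    x.init n = y.init n ↔ ∀ i < n, x.1 i = y.1 i := by
  simp [PathSpace.init]

lemma PathSpace.init_prefix (x : PathSpace T) {m n : ℕ} (h : m ≤ n) : x.init m <+: x.init n := by
  obtain ⟨d, rfl⟩ := Nat.exists_eq_add_of_le h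
  simp [PathSpace.init, List.range_add]

lemma PathSpace.getElem_init (x : PathSpace T) {n i : ℕ} (h : i < (x.init n).length) :
    (x.init n)[i] = x.1 i := by
  simp [PathSpace.init]

lemma PathSpace.prefix_init_iff (x : PathSpace T) {s : List ℕ} {n : ℕ} (h : s.length ≤ n) :
    s <+: x.init n ↔ x.init s.length = s := by
  constructor
  · intro hs
    exact (List.prefix_of_prefix_length_le (x.init_prefix h) hs (by simp)).eq_of_length (by simp)
  · intro hs
    rw [← hs]
    exact x.init_prefix h

lemma PathSpace.init_length_of_prefix (x : PathSpace T) {s : List ℕ} {n : ℕ}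
    (h : s <+: x.init n) : x.init s.length = s :=
  (x.prefix_init_iff (by simpa using h.length_le)).1 h

lemma exists_path_through {s : List ℕ} (hs : T.1 s = true) :
    ∃ x : PathSpace T, x.init s.length = s := by
  obtain ⟨-, hpre, hext⟩ := T.2
  have hnext : ∀ t : {t // T.1 t = true}, ∃ a, T.1 (t.1 ++ [a]) = true := by
    rintro ⟨t, ht⟩
    obtain ⟨_, hu, ⟨v, rfl⟩, hne⟩ := hext t ht
    rcases v with _ | ⟨a, v⟩
    · simp at hne
    · exact ⟨a, hpre _ _ ⟨v, by simp⟩ hu⟩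
  choose a ha using hnext
  let L : ℕ → {t // T.1 t = true} := fun n => Nat.rec ⟨s, hs⟩ (fun _ t => ⟨t.1 ++ [a t], ha t⟩) n
  have hlen : ∀ n, (L n).1.length = s.length + n := by
    intro n
    induction n with
    | zero => rfl
    | succ n ih =>
      change ((L n).1 ++ [a (L n)]).length = _
      simp [ih, Nat.add_assoc]
  have hmono : ∀ m n, m ≤ n → (L m).1 <+: (L n).1 := by
    intro m n h
    induction n, h using Nat.le_induction with
    | base => exact List.prefix_rfl
    | succ n _ ih => exact ih.trans ⟨[a (L n)], rfl⟩
  have hx : ∀ n i, i < s.length + n → (L n).1.getD i 0 = (L (i + 1)).1.getD i 0 := by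
    intro n i hi
    have h₁ := hmono n _ (le_max_left n (i + 1))
    have h₂ := hmono (i + 1) _ (le_max_right n (i + 1))
    have hi₁ : i < (L n).1.length := by rw [hlen]; exact hi
    have hi₂ : i < (L (i + 1)).1.length := lt_of_lt_of_eq (by omega) (hlen (i + 1)).symm
    rw [List.getD_eq_getElem _ _ hi₁, List.getD_eq_getElem _ _ hi₂, h₁.getElem, h₂.getElem]
  have hinit : ∀ n, (List.range (s.length + n)).map (fun i => (L (i + 1)).1.getD i 0) =
      (L n).1 := by
    intro n
    refine List.ext_getElem (by simp [hlen]) fun i h₁ h₂ => ?_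
    have := hx n i (by simpa using h₁)
    rw [List.getD_eq_getElem _ _ h₂] at this
    simpa using this.symm
  refine ⟨⟨fun i => (L (i + 1)).1.getD i 0, fun n => ?_⟩, hinit 0⟩
  refine hpre _ _ ?_ (L n).2
  rw [← hinit n, Nat.add_comm, List.range_add, List.map_append]
  exact ⟨_, rfl⟩

lemma exists_map_of_codesMap {f : List ℕ → ℕ} (hf : CodesMap S.1 T.1 f) :
    ∃ F : PathSpace S → PathSpace T, UniformContinuous F ∧
      ∀ x n, (F x).init (decodeAt f (x.init n)).length = decodeAt f (x.init n) := by
  obtain ⟨hT, hmono, hlen⟩ := hf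
  choose k hk using hlen
  have hk' : ∀ (x : PathSpace S) n, n ≤ (decodeAt f (x.init (k n))).length :=
    fun x n => hk n _ (x.2 _) (by simp)
  let F : PathSpace S → ℕ → ℕ := fun x n => (decodeAt f (x.init (k (n + 1)))).getD n 0
  have hF : ∀ x m n, n < (decodeAt f (x.init m)).length →
      (decodeAt f (x.init m)).getD n 0 = F x n := by
    intro x m n hn
    have h₁ := hmono _ _ (x.2 _) (x.init_prefix (le_max_left m (k (n + 1))))
    have h₂ := hmono _ _ (x.2 _) (x.init_prefix (le_max_right m (k (n + 1))))
    have hn' : n < (decodeAt f (x.init (k (n + 1)))).length := hk' x (n + 1)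
    simp only [F]
    rw [List.getD_eq_getElem _ _ hn, List.getD_eq_getElem _ _ hn', h₁.getElem, h₂.getElem]
  have hinit : ∀ x m, (List.range (decodeAt f (x.init m)).length).map (F x) =
      decodeAt f (x.init m) := by
    intro x m
    refine List.ext_getElem (by simp) fun i h₁ h₂ => ?_
    have := hF x m i h₂
    rw [List.getD_eq_getElem _ _ h₂] at this
    simpa using this.symm
  refine ⟨fun x => ⟨F x, fun n => ?_⟩, ?_, hinit⟩
  · refine T.2.2.1 _ _ ?_ (hT _ (x.2 (k n)))
    change _ <+: decodeAt f (x.init (k n))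
    rw [← hinit x (k n)]
    obtain ⟨d, hd⟩ := Nat.exists_eq_add_of_le (hk' x n)
    rw [hd, List.range_add, List.map_append]
    exact ⟨_, rfl⟩
  · refine PathSpace.uniformContinuous_iff.2 fun n => ⟨k n, fun x y h i hi => ?_⟩
    have hxy := PathSpace.init_eq_iff.2 h
    have hi' := hi.trans_le (hk' x n)
    change F x i = F y i
    rw [← hF x (k n) i hi', ← hF y (k n) i (hxy ▸ hi'), hxy]

lemma leftInverse_of_codes {f g : List ℕ → ℕ} (hf : CodesMap S.1 T.1 f) (hg : CodesMap T.1 S.1 g)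
    (hfg : CodesLeftInverse S.1 f g) {F : PathSpace S → PathSpace T} {G : PathSpace T → PathSpace S}
    (hF : ∀ x n, (F x).init (decodeAt f (x.init n)).length = decodeAt f (x.init n))
    (hG : ∀ x n, (G x).init (decodeAt g (x.init n)).length = decodeAt g (x.init n)) :
    Function.LeftInverse G F := by
  intro x
  apply Subtype.ext
  funext i
  obtain ⟨k, hk⟩ := hg.2.2 (i + 1)
  obtain ⟨k', hk'⟩ := hf.2.2 k
  obtain ⟨N, hN⟩ : ∃ N, N = max k' (i + 1) := ⟨_, rfl⟩
  have h₁ : k ≤ (decodeAt f (x.init N)).length := hk' _ (x.2 _) (by simp [hN])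
  have h₂ : i + 1 ≤ (decodeAt g (decodeAt f (x.init N))).length := hk _ (hf.1 _ (x.2 _)) h₁
  have h₃ := hG (F x) (decodeAt f (x.init N)).length
  rw [hF] at h₃
  have hGi : (decodeAt g (decodeAt f (x.init N)))[i] = (G (F x)).1 i := by
    rw [List.getElem_of_eq h₃.symm h₂]
    exact PathSpace.getElem_init _ _
  have hi : i < (x.init N).length := by simp [hN]
  rw [← hGi, ← x.getElem_init hi]
  rcases hfg _ (x.2 N) with h | h
  · exact h.getElem _
  · exact (h.getElem _).symm

-- Send `s` to the longest initial segment, of length at most `s.length`, shared by the images of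
-- all paths through `s`. The bound makes the maximum exist even when `F` is constant there, and
-- uniform continuity makes these lengths grow uniformly.
open Classical in
lemma exists_codesMap {F : PathSpace S → PathSpace T} (hF : UniformContinuous F) :
    ∃ f, CodesMap S.1 T.1 f ∧ ∀ x n, (F x).init (decodeAt f (x.init n)).length =
      decodeAt f (x.init n) := by
  let P : List ℕ → ℕ → Prop := fun s n => n ≤ s.length ∧
    ∀ x y : PathSpace S, x.init s.length = s → y.init s.length = s → (F x).init n = (F y).init n
  have hP0 : ∀ s, P s 0 := fun s => ⟨Nat.zero_le _, fun _ _ _ _ => rfl⟩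
  let N : List ℕ → ℕ := fun s => Nat.findGreatest (P s) s.length
  have hN : ∀ s, P s (N s) := fun s => Nat.findGreatest_spec (Nat.zero_le _) (hP0 s)
  have hmax : ∀ s n, P s n → n ≤ N s := fun s n h => Nat.le_findGreatest h.1 h
  let φ : List ℕ → List ℕ := fun s =>
    if h : S.1 s = true then (F (exists_path_through h).choose).init (N s) else []
  have hφ : ∀ (x : PathSpace S) n, φ (x.init n) = (F x).init (N (x.init n)) := by
    intro x n
    have h : S.1 (x.init n) = true := x.2 n
    simp only [φ, h, dif_pos]
    exact (hN _).2 _ _ (exists_path_through h).choose_spec (by simp)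
  let f : List ℕ → ℕ := fun s => Denumerable.eqv (List ℕ) (φ s)
  have hf : ∀ s, decodeAt f s = φ s := fun s => by simp [decodeAt, f]
  refine ⟨f, ⟨fun s hs => ?_, fun s s' hs' hss' => ?_, fun n => ?_⟩, fun x n => ?_⟩
  · obtain ⟨x, hx⟩ := exists_path_through hs
    rw [hf, ← hx, hφ]
    exact (F x).2 _
  · obtain ⟨x, hx⟩ := exists_path_through hs'
    have hxs := x.init_length_of_prefix (hx.symm ▸ hss')
    have hle : N s ≤ N s' := by
      refine hmax _ _ ⟨(hN s).1.trans hss'.length_le, fun y z hy hz => ?_⟩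
      exact (hN s).2 y z (y.init_length_of_prefix (hy.symm ▸ hss'))
        (z.init_length_of_prefix (hz.symm ▸ hss'))
    rw [hf, hf]
    conv_lhs => rw [← hxs]
    conv_rhs => rw [← hx]
    rw [hφ, hφ, hxs, hx]
    exact PathSpace.init_prefix _ hle
  · obtain ⟨m, hm⟩ := PathSpace.uniformContinuous_iff.1 hF n
    refine ⟨max m n, fun s hs hl => ?_⟩
    obtain ⟨x, hx⟩ := exists_path_through hs
    rw [hf, ← hx, hφ, PathSpace.length_init, hx]
    refine hmax _ _ ⟨(le_max_right _ _).trans hl, fun y z hy hz => ?_⟩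
    rw [PathSpace.init_eq_iff]
    refine hm y z fun i hi => ?_
    exact PathSpace.init_eq_iff.1 (hy.trans hz.symm) i (hi.trans_le ((le_max_left _ _).trans hl))
  · rw [hf, hφ, PathSpace.length_init]

lemma codesLeftInverse_of_leftInverse {f g : List ℕ → ℕ} {F : PathSpace S → PathSpace T}
    {G : PathSpace T → PathSpace S} (hGF : Function.LeftInverse G F)
    (hF : ∀ x n, (F x).init (decodeAt f (x.init n)).length = decodeAt f (x.init n))
    (hG : ∀ x n, (G x).init (decodeAt g (x.init n)).length = decodeAt g (x.init n)) :
    CodesLeftInverse S.1 f g := by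
  intro s hs
  obtain ⟨x, hx⟩ := exists_path_through hs
  have h := hG (F x) (decodeAt f s).length
  have h' := hF x s.length
  rw [hx] at h'
  rw [h', hGF] at h
  rw [← h, ← hx]
  rcases le_total (decodeAt g (decodeAt f (x.init s.length))).length s.length with hle | hle
  · exact .inl (x.init_prefix hle)
  · exact .inr (x.init_prefix hle)

lemma congU_iff_exists_codesEquiv : CongU S T ↔ ∃ f g, CodesEquiv S.1 T.1 f g := by
  constructor
  · rintro ⟨F⟩
    obtain ⟨f, hf, hFf⟩ := exists_codesMap F.uniformContinuous
    obtain ⟨g, hg, hGg⟩ := exists_codesMap F.symm.uniformContinuous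
    exact ⟨f, g, hf, hg, codesLeftInverse_of_leftInverse F.left_inv hFf hGg,
      codesLeftInverse_of_leftInverse F.right_inv hGg hFf⟩
  · rintro ⟨f, g, hf, hg, hfg, hgf⟩
    obtain ⟨F, hF, hFf⟩ := exists_map_of_codesMap hf
    obtain ⟨G, hG, hGg⟩ := exists_map_of_codesMap hg
    exact ⟨⟨⟨F, G, leftInverse_of_codes hf hg hfg hFf hGg, leftInverse_of_codes hg hf hgf hGg hFf⟩,
      hF, hG⟩⟩

end Codes

/-! ### Analyticity of uniform homeomorphism -/

section Measurability

variable {X : Type*} [MeasurableSpace X]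

lemma measurable_decodeAt {f : X → List ℕ → ℕ} (hf : Measurable f) (s : List ℕ)
    (P : List ℕ → Prop) : Measurable fun x => P (decodeAt (f x) s) :=
  (measurable_from_top (f := fun n => P ((Denumerable.eqv (List ℕ)).symm n))).comp
    ((measurable_pi_apply s).comp hf)

lemma measurable_apply_eq_true {S : X → List ℕ → Bool} (hS : Measurable S) (s : List ℕ) :
    Measurable fun x => S x s = true :=
  (measurable_from_top (f := fun b : Bool => b = true)).comp ((measurable_pi_apply s).comp hS)

lemma measurable_codesMap {S T : X → List ℕ → Bool} {f : X → List ℕ → ℕ} (hS : Measurable S)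
    (hT : Measurable T) (hf : Measurable f) : Measurable fun x => CodesMap (S x) (T x) (f x) := by
  refine .and (.forall fun s => .imp (measurable_apply_eq_true hS s) ?_)
    (.and (.forall fun s => .forall fun s' => .imp (measurable_apply_eq_true hS s')
      (.imp measurable_const ?_)) (.forall fun n => .exists fun k => .forall fun s =>
        .imp (measurable_apply_eq_true hS s) (.imp measurable_const ?_)))
  -- Quantifying over the countably many possible values of the inner term removes the composition
  -- of two varying functions.
  · have h : (fun x => T x (decodeAt (f x) s) = true) =
        fun x => ∀ t, decodeAt (f x) s = t → T x t = true := by simp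
    rw [h]
    exact .forall fun t => .imp (measurable_decodeAt hf s (· = t)) (measurable_apply_eq_true hT t)
  · have h : (fun x => decodeAt (f x) s <+: decodeAt (f x) s') =
        fun x => ∀ t, decodeAt (f x) s = t → t <+: decodeAt (f x) s' := by simp
    rw [h]
    exact .forall fun t => .imp (measurable_decodeAt hf s (· = t)) (measurable_decodeAt hf s' _)
  · exact measurable_decodeAt hf s (fun t => n ≤ t.length)

lemma measurable_codesLeftInverse {S : X → List ℕ → Bool} {f g : X → List ℕ → ℕ}
    (hS : Measurable S) (hf : Measurable f) (hg : Measurable g) :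
    Measurable fun x => CodesLeftInverse (S x) (f x) (g x) := by
  refine .forall fun s => .imp (measurable_apply_eq_true hS s) ?_
  have h : (fun x => decodeAt (g x) (decodeAt (f x) s) <+: s ∨
      s <+: decodeAt (g x) (decodeAt (f x) s)) =
      fun x => ∀ t, decodeAt (f x) s = t → decodeAt (g x) t <+: s ∨ s <+: decodeAt (g x) t := by
    simp
  rw [h]
  exact .forall fun t => .imp (measurable_decodeAt hf s (· = t))
    (measurable_decodeAt hg t fun u => u <+: s ∨ s <+: u)

lemma measurableSet_isPrunedTree :
    MeasurableSet {χ : List ℕ → Bool | IsPrunedTree {s | χ s = true}} := by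
  refine measurableSet_setOfPred.2 ?_
  have h := fun s => measurable_apply_eq_true (measurable_id (α := List ℕ → Bool)) s
  refine .and (.exists h) (.and (.forall fun s => .forall fun t => .imp measurable_const
    (.imp (h t) (h s))) (.forall fun s => .imp (h s) (.exists fun t => .and (h t) ?_)))
  exact measurable_const

instance : SecondCountableTopology PrunedTree :=
  TopologicalSpace.Subtype.secondCountableTopology _

instance : StandardBorelSpace PrunedTree := measurableSet_isPrunedTree.standardBorel

lemma analyticSet_congU :
    AnalyticSet {p : PrunedTree × PrunedTree | CongU p.1 p.2} := by
  let C : Set ((PrunedTree × PrunedTree) × (List ℕ → ℕ) × (List ℕ → ℕ)) :=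
    {q | CodesEquiv q.1.1.1 q.1.2.1 q.2.1 q.2.2}
  have hS : Measurable fun q : (PrunedTree × PrunedTree) × (List ℕ → ℕ) × (List ℕ → ℕ) =>
    q.1.1.1 := measurable_subtype_coe.comp (measurable_fst.comp measurable_fst)
  have hT : Measurable fun q : (PrunedTree × PrunedTree) × (List ℕ → ℕ) × (List ℕ → ℕ) =>
    q.1.2.1 := measurable_subtype_coe.comp (measurable_snd.comp measurable_fst)
  have hf : Measurable fun q : (PrunedTree × PrunedTree) × (List ℕ → ℕ) × (List ℕ → ℕ) =>
    q.2.1 := measurable_fst.comp measurable_snd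
  have hg : Measurable fun q : (PrunedTree × PrunedTree) × (List ℕ → ℕ) × (List ℕ → ℕ) =>
    q.2.2 := measurable_snd.comp measurable_snd
  have hC : MeasurableSet C := measurableSet_setOfPred.2
    (.and (measurable_codesMap hS hT hf) (.and (measurable_codesMap hT hS hg)
      (.and (measurable_codesLeftInverse hS hf hg) (measurable_codesLeftInverse hT hg hf))))
  convert! hC.analyticSet_image measurable_fst
  ext p
  simp [C, congU_iff_exists_codesEquiv]

end Measurability

/-! ### A diagonal analytic set and the failure of Borelness -/

section NotBorel

/-- Whether a code of a closed subset of `2^ℕ × ℕ^ℕ` accepts the pair of initial segments of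
length `n`. -/
def acceptsInit (c x : ℕ → Bool) (z : ℕ → ℕ) (n : ℕ) : Prop :=
  c (Encodable.encode ((List.range n).map x, (List.range n).map z)) = true

/-- The codes of closed sets whose projection contains the code. -/
def diagonalSet : Set (ℕ → Bool) := {c | ∃ z : ℕ → ℕ, ∀ n, acceptsInit c c z n}

lemma polishSpace_cantor : PolishSpace (ℕ → Bool) := { }

lemma isLocallyConstant_map_apply {α X : Type*} [TopologicalSpace α] [DiscreteTopology α]
    [TopologicalSpace X] {f : X → ℕ → α} (hf : Continuous f) (l : List ℕ) :
    IsLocallyConstant fun x => l.map (f x) := by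
  induction l with
  | nil => exact IsLocallyConstant.const _
  | cons a l ih =>
    exact ((IsLocallyConstant.iff_continuous _).2 ((continuous_apply a).comp hf)).comp₂ ih List.cons

lemma analyticSet_diagonalSet : AnalyticSet diagonalSet := by
  have hcl : IsClosed {p : (ℕ → Bool) × (ℕ → ℕ) | ∀ n, acceptsInit p.1 p.1 p.2 n} := by
    have h : {p : (ℕ → Bool) × (ℕ → ℕ) | ∀ n, acceptsInit p.1 p.1 p.2 n} =
        ⋂ (n) (k), {p | Encodable.encode ((List.range n).map p.1, (List.range n).map p.2) ≠ k} ∪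
          {p | p.1 k = true} := by
      ext p
      simp only [acceptsInit, mem_ofPred_eq, mem_iInter, mem_union, ne_eq]
      refine forall_congr' fun n => ⟨fun h k => ?_, fun h => ?_⟩
      · rw [← imp_iff_not_or]
        rintro rfl
        exact h
      · exact (h _).resolve_left (not_not.2 rfl)
    rw [h]
    refine isClosed_iInter fun n => isClosed_iInter fun k => .union ?_ ?_
    · exact (((isLocallyConstant_map_apply continuous_fst _).comp₂
        (isLocallyConstant_map_apply continuous_snd _)
        fun u v => Encodable.encode (u, v)).isOpen_fiber k).isClosed_compl
    · exact isClosed_singleton.preimage ((continuous_apply k).comp continuous_fst)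
  have : PolishSpace ((ℕ → Bool) × (ℕ → ℕ)) := { }
  convert! hcl.analyticSet.image_of_continuous continuous_fst
  ext c
  simp [diagonalSet]

/-- Cantor's diagonal argument: if the complement were the range of a continuous `f`, a code `c` for
the graph of `f` would lie in `diagonalSet` exactly when it lies in the complement. -/
lemma not_analyticSet_compl_diagonalSet : ¬ AnalyticSet diagonalSetᶜ := by
  intro h
  rw [AnalyticSet] at h
  rcases h with h | ⟨f, hf, hrange⟩
  · have : (fun _ => false) ∈ diagonalSetᶜ := by simp [diagonalSet, acceptsInit]
    rw [h] at this
    exact this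
  classical
  -- `c` accepts exactly the pairs of initial segments of points `(f y, y)`. Continuity of `f` makes
  -- this graph closed, so it is recovered from its initial segments.
  let c : ℕ → Bool := fun k => decide (∃ (y : ℕ → ℕ) (n : ℕ),
    k = Encodable.encode ((List.range n).map (f y), (List.range n).map y))
  have hc : ∀ x z n, acceptsInit c x z n ↔ ∃ y, (∀ i < n, f y i = x i) ∧ ∀ i < n, y i = z i := by
    intro x z n
    simp only [acceptsInit, c, decide_eq_true_eq, Encodable.encode_inj, Prod.mk.injEq]
    constructor
    · rintro ⟨y, m, h₁, h₂⟩
      obtain rfl : n = m := by simpa using congrArg List.length h₁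
      simp only [List.map_inj_left, List.mem_range] at h₁ h₂
      exact ⟨y, fun i hi => (h₁ i hi).symm, fun i hi => (h₂ i hi).symm⟩
    · rintro ⟨y, h₁, h₂⟩
      refine ⟨y, n, ?_, ?_⟩ <;> simp only [List.map_inj_left, List.mem_range]
      · exact fun i hi => (h₁ i hi).symm
      · exact fun i hi => (h₂ i hi).symm
  have key : c ∈ diagonalSet ↔ c ∈ range f := by
    simp only [diagonalSet, mem_ofPred_eq, hc]
    constructor
    · rintro ⟨z, hz⟩
      refine ⟨z, funext fun i => ?_⟩
      have hopen : IsOpen {y | f y i = f z i} :=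
        (isOpen_discrete {f z i}).preimage ((continuous_apply i).comp hf)
      obtain ⟨N, hN⟩ := exists_forall_lt_imp_mem hopen (z := z) rfl
      obtain ⟨y, h₁, h₂⟩ := hz (max N (i + 1))
      have h₃ : f y i = f z i := hN y fun j hj => h₂ j (hj.trans_le (le_max_left _ _))
      rw [← h₃]
      exact h₁ i (lt_of_lt_of_le (Nat.lt_succ_self i) (le_max_right _ _))
    · rintro ⟨z, hz⟩
      exact ⟨z, fun n => ⟨z, fun i _ => congrFun hz i, fun _ _ => rfl⟩⟩
  rw [hrange] at key
  exact (iff_not_self key)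

lemma not_measurableSet_congU :
    ¬ MeasurableSet {p : PrunedTree × PrunedTree | CongU p.1 p.2} := by
  intro h
  obtain ⟨f, hf, hpre⟩ := exists_continuous_preimage_congU isTopologicalBasis_isClopen
    analyticSet_diagonalSet
  have := polishSpace_cantor
  have hm := h.preimage hf.measurable
  rw [hpre] at hm
  exact not_analyticSet_compl_diagonalSet hm.compl.analyticSet

end NotBorel

end UniformHomeo

theorem proposition2p2 :
    UniformHomeo.BorelReducible UniformHomeo.GI UniformHomeo.CongU ∧
      UniformHomeo.IsCompleteAnalytic
        {p : UniformHomeo.PrunedTree × UniformHomeo.PrunedTree | UniformHomeo.CongU p.1 p.2} ∧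
      ¬ MeasurableSet
        {p : UniformHomeo.PrunedTree × UniformHomeo.PrunedTree | UniformHomeo.CongU p.1 p.2} :=
  ⟨UniformHomeo.borelReducible_gi_congU,
    ⟨UniformHomeo.analyticSet_congU,
      fun _ _ _ hY _ hB => UniformHomeo.exists_continuous_preimage_congU hY hB⟩,
    UniformHomeo.not_measurableSet_congU⟩
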